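/- Let $U,D\ge 0$ be integers, let $\mathcal S=\{(\pm1\pm i)/\sqrt2\}$ be the QPSK constellation, and let $\|w\|_0$ denote the number of nonzero entries of a vector $w$. On a probability space let - the pilot matrix $S_T\in\mathbb C^{U\times U}$ (square, $T=U$) be distributed according to the power-normalized Haar measure, i.e. $S_T=\sqrt U\,Q$ with $Q$ Haar distributed on the group of unitary $U\times U$ matrices (so $\|S_T\|_F^2=U^2$); - the data matrix $S_D$ be uniformly distributed on $\mathcal S^{U\times D}$ and independent of $S_T$; - the signal of a single-antenna jammer, $w_T\in\mathbb C^{U}$ in the pilot phase and $w_D\in\mathbb C^{D}$ in the data phase, be deterministic or random, with $(w_T,w_D)$ independent of $(S_T,S_D)$ (the pilots and data are hidden from the jammer). The jammer is *eclipsed* (with least-squares channel estimation) if there is $\tilde S_D\in\mathcal S^{U\times D}$ with $\tilde S_D\ne S_D$ such that the matrix $$\begin{bmatrix} S_D-\tilde S_D\\ w_D^{\mathsf T}-w_T^{\mathsf T}S_T^{+}\tilde S_D\end{bmatrix}$$ has rank at most $1$, where $S_T^{+}=S_T^{\mathsf H}(S_TS_T^{\mathsf H})^{-1}$ is the pseudoinverse.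 Let $p$ be the conditional probability, given $(w_T,w_D)$, that the jammer is eclipsed (for a deterministic jammer signal, simply the probability of this event). Then eclipsing is a measurable event, and almost surely: 1. If $w_T=0$, then $$p\le p_e(w_D)=\begin{cases}1 & \text{if } w_D=0,\\ 1-\left(1-\dfrac{2^{\|w_D\|_0}-1}{4^{\|w_D\|_0-1}}\right)^{U} & \text{otherwise.}\end{cases}$$ 2. If $w_T\neq0$, and if $U\ge2$ or $w_D\ne0$, then $$p\le 1-\left(1-\frac{2^{D}-1}{4^{D-1}}\right)^{U}.$$ 3. If $w_T\ne0$, $U\ge2$ and $D\ge2$, then also $$p\le 1-\left(1-\frac{2^{D}-1}{4^{D}-1}\right)^{U}.$$ -/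

import Mathlib

open MeasureTheory ProbabilityTheory

open scoped Matrix

namespace Jamming

/-- Complex matrices carry the product (equivalently, Borel) σ-algebra. -/
noncomputable instance matrixMeasurableSpace (m n : ℕ) : MeasurableSpace (Matrix (Fin m) (Fin n) ℂ) :=
  inferInstanceAs (MeasurableSpace (Fin m → Fin n → ℂ))

instance matrixBorelSpace (m n : ℕ) : BorelSpace (Matrix (Fin m) (Fin n) ℂ) :=
  inferInstanceAs (BorelSpace (Fin m → Fin n → ℂ))

instance unitaryCompactSpace (n : ℕ) : CompactSpace (Matrix.unitaryGroup (Fin n) ℂ) := by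
  apply isCompact_iff_compactSpace.mp
  have hK : IsCompact (Set.univ.pi fun _ : Fin n => Set.univ.pi fun _ : Fin n =>
      Metric.closedBall (0 : ℂ) 1) :=
    isCompact_univ_pi fun _ => isCompact_univ_pi fun _ => isCompact_closedBall 0 1
  refine IsCompact.of_isClosed_subset (X := Matrix (Fin n) (Fin n) ℂ) hK ?_ ?_
  · have h : ((Matrix.unitaryGroup (Fin n) ℂ : Submonoid (Matrix (Fin n) (Fin n) ℂ)) :
        Set (Matrix (Fin n) (Fin n) ℂ)) = {A | A * star A = 1} := by
      ext A
      exact Matrix.mem_unitaryGroup_iff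
    rw [h]
    exact isClosed_eq (by fun_prop) continuous_const
  · intro A hA i _ j _
    simpa using entry_norm_bound_of_unitary hA i j

/-- The QPSK constellation, scaled to unit symbol power: `{(±1 ± i) / √2}`. -/
def qpsk : Set ℂ :=
  {z | ∃ a b : ℝ, (a = 1 ∨ a = -1) ∧ (b = 1 ∨ b = -1) ∧
    z = ((a : ℂ) + (b : ℂ) * Complex.I) / ((Real.sqrt 2 : ℝ) : ℂ)}

/-- The `U × D` matrices all of whose entries are QPSK symbols. -/
def dataMatrices (U D : ℕ) : Set (Matrix (Fin U) (Fin D) ℂ) :=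
  {S | ∀ u k, S u k ∈ qpsk}

/-- The Haar probability measure on the group of unitary `n × n` matrices. -/
noncomputable def haarUnitary (n : ℕ) : Measure (Matrix.unitaryGroup (Fin n) ℂ) :=
  Measure.haarMeasure ⊤

/-- The power-normalized Haar measure on square pilot matrices: the law of `√n • Q` with `Q`
Haar distributed on the unitary group, so that the squared Frobenius norm is `n ^ 2`. -/
noncomputable def pilotLaw (n : ℕ) : Measure (Matrix (Fin n) (Fin n) ℂ) :=
  (haarUnitary n).map fun Q : Matrix.unitaryGroup (Fin n) ℂ =>
    ((Real.sqrt n : ℝ) : ℂ) • (Q : Matrix (Fin n) (Fin n) ℂ)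

/-- The Moore-Penrose pseudoinverse `Sᴴ (S Sᴴ)⁻¹` of a square or wide matrix `S` of full row
rank. -/
noncomputable def pinv {U T : ℕ} (S : Matrix (Fin U) (Fin T) ℂ) : Matrix (Fin T) (Fin U) ℂ :=
  Sᴴ * (S * Sᴴ)⁻¹

/-- The virtual interference matrix `[S_D - S'; W_D - W_T S_T⁺ S']` belonging to a candidate data
matrix `S'` when the channel is estimated by least squares from the pilots `S_T`. -/
noncomputable def virtualInterference {I U T D : ℕ}
    (ST : Matrix (Fin U) (Fin T) ℂ) (SD : Matrix (Fin U) (Fin D) ℂ)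
    (WT : Matrix (Fin I) (Fin T) ℂ) (WD : Matrix (Fin I) (Fin D) ℂ)
    (S' : Matrix (Fin U) (Fin D) ℂ) : Matrix (Fin U ⊕ Fin I) (Fin D) ℂ :=
  Matrix.fromRows (SD - S') (WD - WT * pinv ST * S')

/-- An `I`-antenna jammer is eclipsed in a frame: some incorrect candidate data matrix makes the
virtual interference matrix have rank at most `I`. -/
def Eclipsed {I U T D : ℕ}
    (ST : Matrix (Fin U) (Fin T) ℂ) (SD : Matrix (Fin U) (Fin D) ℂ)
    (WT : Matrix (Fin I) (Fin T) ℂ) (WD : Matrix (Fin I) (Fin D) ℂ) : Prop :=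
  ∃ S' ∈ dataMatrices U D, S' ≠ SD ∧ (virtualInterference ST SD WT WD S').rank ≤ I

/-- The signal of a single-antenna jammer as a matrix with one row. -/
def rowMatrix {n : ℕ} (w : Fin n → ℂ) : Matrix (Fin 1) (Fin n) ℂ :=
  Matrix.replicateRow (Fin 1) w

/-- The event that a single-antenna jammer with signals `wT` (pilot phase) and `wD` (data phase) is
eclipsed. -/
def eclipseEvent {Ω : Type*} {U T D : ℕ}
    (ST : Ω → Matrix (Fin U) (Fin T) ℂ) (SD : Ω → Matrix (Fin U) (Fin D) ℂ)
    (wT : Ω → Fin T → ℂ) (wD : Ω → Fin D → ℂ) : Set Ω :=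
  {ω | Eclipsed (ST ω) (SD ω) (rowMatrix (wT ω)) (rowMatrix (wD ω))}

/-- The σ-algebra generated by the transmit signal of the jammer. -/
noncomputable abbrev jammerSigma {Ω : Type*} {T D : ℕ} (wT : Ω → Fin T → ℂ) (wD : Ω → Fin D → ℂ) :
    MeasurableSpace Ω :=
  MeasurableSpace.comap (fun ω => (wT ω, wD ω)) inferInstance

/-- `1 - (1 - (2 ^ L - 1) / 4 ^ (L - 1)) ^ U`. (For `L = 0` the quotient is `0`, whatever the
meaning of the exponent.) -/
noncomputable def supportBound (U L : ℕ) : ℝ :=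
  1 - (1 - ((2 : ℝ) ^ L - 1) / (4 : ℝ) ^ (L - 1)) ^ U

/-- The bound for a jammer that is silent in the pilot phase; `hammingNorm w` is the number of
nonzero entries of `w`. -/
noncomputable def silentPilotBound (U : ℕ) {D : ℕ} (w : Fin D → ℂ) : ℝ :=
  if w = 0 then 1 else supportBound U (hammingNorm w)

end Jamming

/-! A matrix has rank at most one exactly when its 2 × 2 minors vanish. Since the candidate differs
from `S_D`, some row `e` of the difference is nonzero, and eclipsing means that every row, the
jammer row included, is a multiple of `e`. By independence the jammer signal can be frozen, so it
suffices to bound `eclipseProb` for deterministic signals.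

If `w_T = 0`, the jammer row is `w_D`. For `w_D ≠ 0`, `e` is then a nonzero multiple of `w_D`, so
some row of `S_D` can be moved along `w_D` to another QPSK vector. Such rows are counted in
`card_confusable_fiber`: once the entry at a nonzero of `w_D` is fixed, only three scalings of `w_D`
are possible, related by a quarter turn and by addition, and inclusion-exclusion yields the `-1` in
`2 ^ L - 1`. Independence of the rows gives the power `U`.

If `w_T ≠ 0`, then `w_T S_T⁺` is, up to conjugation and scaling, a nonzero vector rotated by a Haar
unitary, and almost surely avoids any given hyperplane (`haarUnitary_hyperplane`). There are only
finitely many pairs of data matrix and candidate, so almost surely a minor through the jammer row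
vanishes only if the coefficients of `w_T S_T⁺` in it vanish. This makes all rows of `S_D` and `w_D`
parallel to `e` (`ae_collinear_of_eclipsed`). If `U ≥ 2` or `w_D ≠ 0`, some row is then determined
by one of its entries and the rest, so for `D ≥ 1` the probability is at most `1 / 4 ^ (D - 1)`,
which is below both claimed bounds. -/

namespace Jamming

/-! ### Rank one, conditioning on the jammer, and measurability of eclipsing -/

/-- A matrix over a field has rank at most one iff all its `2 × 2` minors vanish. -/
theorem rank_le_one_iff_minors {K m n : Type*} [Field K] [Finite m] [Fintype n]
    (M : Matrix m n K) :
    M.rank ≤ 1 ↔ ∀ i j k l, M i k * M j l = M i l * M j k := by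
  constructor
  · intro h i j k l
    rw [Matrix.rank_eq_finrank_span_row] at h
    obtain ⟨v, hv⟩ := finrank_le_one_iff.mp h
    obtain ⟨a, ha⟩ := hv ⟨M i, Submodule.subset_span ⟨i, rfl⟩⟩
    obtain ⟨b, hb⟩ := hv ⟨M j, Submodule.subset_span ⟨j, rfl⟩⟩
    have ha' : ∀ x, M i x = a * (v : n → K) x := fun x =>
      (congrFun (congrArg Subtype.val ha) x).symm
    have hb' : ∀ x, M j x = b * (v : n → K) x := fun x =>
      (congrFun (congrArg Subtype.val hb) x).symm
    rw [ha', ha', hb', hb']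
    ring
  · intro h
    by_cases h0 : M = 0
    · simp [h0]
    · obtain ⟨i, k, hik⟩ : ∃ i k, M i k ≠ 0 := by
        by_contra! hc
        exact h0 (Matrix.ext hc)
      have : M = Matrix.vecMulVec (fun j => M j k / M i k) (M i) := by
        ext j l
        rw [Matrix.vecMulVec_apply, div_mul_eq_mul_div, eq_div_iff hik, mul_comm, h i j k l,
          mul_comm]
      rw [this]
      exact Matrix.rank_vecMulVec_le _ _

/-- Conditional probability of an event depending on two independent random variables, given one
of them. -/
theorem condProb_ae_eq_of_indepFun {Ω α β : Type*} [MeasurableSpace Ω] [MeasurableSpace α]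
    [StandardBorelSpace α] [MeasurableSpace β] {P : Measure Ω} [IsProbabilityMeasure P]
    {X : Ω → α} {Y : Ω → β} (hX : Measurable X) (hY : Measurable Y) (h : IndepFun X Y P)
    {F : Set (β × α)} (hF : MeasurableSet F) :
    P⟦{ω | (Y ω, X ω) ∈ F} | MeasurableSpace.comap Y inferInstance⟧ =ᵐ[P]
      fun ω => (P.map X).real {x | (Y ω, x) ∈ F} := by
  obtain ⟨ω₀⟩ : Nonempty Ω := nonempty_of_isProbabilityMeasure P
  have : Nonempty α := ⟨X ω₀⟩
  have : IsProbabilityMeasure (P.map X) := Measure.isProbabilityMeasure_map hX.aemeasurable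
  -- Under independence the conditional law of `X` given `Y` is the constant kernel.
  have hκ : condDistrib X Y P =ᵐ[P.map Y] Kernel.const β (P.map X) := by
    refine condDistrib_ae_eq_of_measure_eq_compProd Y hX.aemeasurable ?_
    rw [Measure.compProd_const]
    exact (indepFun_iff_map_prod_eq_prod_map_map hY.aemeasurable hX.aemeasurable).mp h.symm
  have h1 := condExp_prod_ae_eq_integral_condDistrib (μ := P) (X := Y) (Y := X)
    (f := F.indicator fun _ => (1 : ℝ)) hY hX.aemeasurable
    (stronglyMeasurable_const.indicator hF)
    ((integrable_const (1 : ℝ)).indicator (hF.preimage (hY.prodMk hX)))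
  refine h1.trans ?_
  filter_upwards [ae_of_ae_map hY.aemeasurable hκ] with ω hω
  rw [hω, Kernel.const_apply]
  have hm : MeasurableSet {x | (Y ω, x) ∈ F} := hF.preimage measurable_prodMk_left
  rw [← integral_indicator_one hm]
  rfl

theorem measurable_matrix_of_entries {α : Type*} [MeasurableSpace α] {m n : ℕ}
    {f : α → Matrix (Fin m) (Fin n) ℂ} (h : ∀ i j, Measurable fun a => f a i j) :
    Measurable f :=
  measurable_pi_lambda _ fun i => measurable_pi_lambda _ fun j => h i j

theorem measurable_matrix_entry {m n : ℕ} (i : Fin m) (j : Fin n) :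
    Measurable fun A : Matrix (Fin m) (Fin n) ℂ => A i j :=
  (measurable_pi_apply j).comp (measurable_pi_apply (X := fun _ : Fin m => Fin n → ℂ) i)

/-- Matrix inversion is not continuous at singular matrices, but the adjugate formula leaves only
the scalar inverse `det⁻¹`, which is measurable with the convention `0⁻¹ = 0`. -/
theorem measurable_pinv (U T : ℕ) :
    Measurable (pinv : Matrix (Fin U) (Fin T) ℂ → Matrix (Fin T) (Fin U) ℂ) := by
  have h1 : Continuous fun S : Matrix (Fin U) (Fin T) ℂ => (S * Sᴴ).det := by fun_prop
  have h2 : Continuous fun S : Matrix (Fin U) (Fin T) ℂ => Sᴴ * (S * Sᴴ).adjugate := by fun_prop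
  have h3 : (pinv : Matrix (Fin U) (Fin T) ℂ → Matrix (Fin T) (Fin U) ℂ) =
      fun S => (S * Sᴴ).det⁻¹ • (Sᴴ * (S * Sᴴ).adjugate) := by
    funext S
    rw [pinv, Matrix.inv_def, Ring.inverse_eq_inv', Matrix.mul_smul]
  rw [h3]
  refine measurable_matrix_of_entries fun i j => ?_
  exact h1.measurable.inv.mul ((measurable_matrix_entry i j).comp h2.measurable)

instance matrixStandardBorelSpace (m n : ℕ) : StandardBorelSpace (Matrix (Fin m) (Fin n) ℂ) :=
  inferInstanceAs (StandardBorelSpace (Fin m → Fin n → ℂ))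

theorem finite_qpsk : qpsk.Finite := by
  refine Set.Finite.subset (Set.Finite.image2
    (fun a b : ℝ => ((a : ℂ) + (b : ℂ) * Complex.I) / ((Real.sqrt 2 : ℝ) : ℂ))
    (Set.toFinite {1, -1}) (Set.toFinite {1, -1})) ?_
  rintro z ⟨a, b, ha, hb, rfl⟩
  exact ⟨a, by simpa using ha, b, by simpa using hb, rfl⟩

theorem finite_dataMatrices (U D : ℕ) : (dataMatrices U D).Finite := by
  have h : (Set.univ.pi fun _ : Fin U => Set.univ.pi fun _ : Fin D => qpsk).Finite :=
    Set.Finite.pi' (fun _ => Set.Finite.pi' fun _ => finite_qpsk) |>.subset (by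
      intro f hf u k
      exact hf u trivial k trivial)
  exact h.subset fun S hS u _ k _ => hS u k

/-- The set of frames, listed as jammer signal and transmit signal, in which a single-antenna
jammer is eclipsed. -/
def eclipseSet (U D : ℕ) : Set (((Fin U → ℂ) × (Fin D → ℂ)) ×
    (Matrix (Fin U) (Fin U) ℂ × Matrix (Fin U) (Fin D) ℂ)) :=
  {p | Eclipsed p.2.1 p.2.2 (rowMatrix p.1.1) (rowMatrix p.1.2)}

theorem measurableSet_eclipseSet (U D : ℕ) : MeasurableSet (eclipseSet U D) := by
  have h : eclipseSet U D = ⋃ S' ∈ dataMatrices U D, {p | S' ≠ p.2.2} ∩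
      ⋂ (i) (j) (k) (l), {p |
        virtualInterference p.2.1 p.2.2 (rowMatrix p.1.1) (rowMatrix p.1.2) S' i k *
          virtualInterference p.2.1 p.2.2 (rowMatrix p.1.1) (rowMatrix p.1.2) S' j l =
        virtualInterference p.2.1 p.2.2 (rowMatrix p.1.1) (rowMatrix p.1.2) S' i l *
          virtualInterference p.2.1 p.2.2 (rowMatrix p.1.1) (rowMatrix p.1.2) S' j k} := by
    ext p
    simp only [eclipseSet, Eclipsed, rank_le_one_iff_minors, Set.mem_ofPred_eq, Set.mem_iUnion,
      Set.mem_inter_iff, Set.mem_iInter, exists_prop]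
  rw [h]
  refine MeasurableSet.biUnion (finite_dataMatrices U D).countable fun S' _ => ?_
  have hent : ∀ i k, Measurable fun p : ((Fin U → ℂ) × (Fin D → ℂ)) ×
      (Matrix (Fin U) (Fin U) ℂ × Matrix (Fin U) (Fin D) ℂ) =>
      virtualInterference p.2.1 p.2.2 (rowMatrix p.1.1) (rowMatrix p.1.2) S' i k := by
    intro i k
    rcases i with u | i
    · exact ((measurable_matrix_entry u k).comp (by fun_prop)).sub_const _
    · simp only [virtualInterference, Matrix.fromRows_apply_inr, Matrix.sub_apply,
        Matrix.mul_apply, rowMatrix, Matrix.replicateRow_apply]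
      have hp : ∀ a b, Measurable fun p : ((Fin U → ℂ) × (Fin D → ℂ)) ×
          (Matrix (Fin U) (Fin U) ℂ × Matrix (Fin U) (Fin D) ℂ) => pinv p.2.1 a b := fun a b =>
        (measurable_matrix_entry a b).comp ((measurable_pinv U U).comp (by fun_prop))
      fun_prop
  refine MeasurableSet.inter ?_ ?_
  · exact (measurableSet_eq_fun measurable_const (by fun_prop)).compl
  · exact MeasurableSet.iInter fun i => MeasurableSet.iInter fun j => MeasurableSet.iInter fun k =>
      MeasurableSet.iInter fun l =>
        measurableSet_eq_fun ((hent i k).mul (hent j l)) ((hent i l).mul (hent j k))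

/-! ### Hyperplanes are null for Haar-rotated vectors -/

/-- If each point outside a null set lies in at most `C` of the translates `{x | g i * x ∈ A}` by
infinitely many group elements, then `A` is null for an invariant probability measure. -/
theorem measure_eq_zero_of_bounded_overlap {G : Type*} [Group G] [MeasurableSpace G]
    [MeasurableMul G] (μ : Measure G) [IsProbabilityMeasure μ] [μ.IsMulLeftInvariant]
    {A : Set G} (hA : MeasurableSet A) (g : ℕ → G) (C : ℕ)
    (h : ∀ᵐ x ∂μ, ∀ s : Finset ℕ, (∀ i ∈ s, g i * x ∈ A) → s.card ≤ C) : μ A = 0 := by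
  classical
  have key : ∀ N : ℕ, (N : ENNReal) * μ A ≤ C := by
    intro N
    -- Double counting: the integral of the number of translates containing a point is `N * μ A` by
    -- invariance, and at most `C` by the overlap bound.
    have h1 : (N : ENNReal) * μ A = ∫⁻ x, ∑ i ∈ Finset.range N,
        ((fun x => g i * x) ⁻¹' A).indicator (fun _ => (1 : ENNReal)) x ∂μ := by
      rw [lintegral_finsetSum _ fun i _ =>
        measurable_const.indicator (hA.preimage (measurable_const_mul (g i)))]
      have : ∀ i, ∫⁻ x, ((fun x => g i * x) ⁻¹' A).indicator (fun _ => (1 : ENNReal)) x ∂μ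
          = μ A := by
        intro i
        rw [lintegral_indicator_const (hA.preimage (measurable_const_mul (g i))), one_mul,
          measure_preimage_mul]
      simp [this]
    rw [h1]
    calc _ ≤ ∫⁻ _, (C : ENNReal) ∂μ := by
          refine lintegral_mono_ae ?_
          filter_upwards [h] with x hx
          have h2 : ∑ i ∈ Finset.range N,
              ((fun x => g i * x) ⁻¹' A).indicator (fun _ => (1 : ENNReal)) x =
              (((Finset.range N).filter fun i => g i * x ∈ A).card : ENNReal) := by
            rw [Finset.card_filter, Nat.cast_sum]
            exact Finset.sum_congr rfl fun i _ => by simp [Set.indicator_apply]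
          rw [h2]
          exact_mod_cast hx _ fun i hi => (Finset.mem_filter.mp hi).2
      _ = C := by simp
  by_contra hne
  have htop : μ A ≠ ⊤ := measure_ne_top μ A
  obtain ⟨N, hN⟩ := ENNReal.exists_nat_mul_gt hne (ENNReal.natCast_ne_top C)
  exact absurd (key N) (not_le.mpr hN)

instance haarUnitary_isProbabilityMeasure (n : ℕ) : IsProbabilityMeasure (haarUnitary n) :=
  ⟨Measure.haarMeasure_self (K₀ := (⊤ : TopologicalSpace.PositiveCompacts
    (Matrix.unitaryGroup (Fin n) ℂ)))⟩

instance haarUnitary_isMulLeftInvariant (n : ℕ) : (haarUnitary n).IsMulLeftInvariant :=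
  Measure.isMulLeftInvariant_haarMeasure _

/-- The diagonal matrix with entries `z, z ^ 2, …, z ^ n` as an element of the unitary group. -/
noncomputable def powerDiagonal (n : ℕ) (z : Circle) : Matrix.unitaryGroup (Fin n) ℂ :=
  ⟨Matrix.diagonal fun k => (z : ℂ) ^ ((k : ℕ) + 1), by
    rw [Matrix.mem_unitaryGroup_iff, Matrix.star_eq_conjTranspose,
      Matrix.diagonal_conjTranspose, Matrix.diagonal_mul_diagonal, ← Matrix.diagonal_one]
    congr 1
    funext k
    simp [← mul_pow, Complex.mul_conj, Circle.normSq_coe]⟩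

theorem measurable_mulVec_unitary {n : ℕ} (w : Fin n → ℂ) (k : Fin n) :
    Measurable fun Q : Matrix.unitaryGroup (Fin n) ℂ =>
      ((Q : Matrix (Fin n) (Fin n) ℂ) *ᵥ w) k := by
  simp only [Matrix.mulVec, dotProduct]
  exact Finset.measurable_sum _ fun j _ =>
    ((measurable_matrix_entry k j).comp measurable_subtype_coe).mul_const _

theorem measurableSet_hyperplane {n : ℕ} (w c : Fin n → ℂ) (d : ℂ) :
    MeasurableSet {Q : Matrix.unitaryGroup (Fin n) ℂ |
      c ⬝ᵥ ((Q : Matrix (Fin n) (Fin n) ℂ) *ᵥ w) = d} := by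
  refine measurableSet_eq_fun ?_ measurable_const
  exact Finset.measurable_sum _ fun j _ => (measurable_mulVec_unitary w j).const_mul _

theorem unitary_mulVec_ne_zero {n : ℕ} (Q : Matrix.unitaryGroup (Fin n) ℂ) {w : Fin n → ℂ}
    (hw : w ≠ 0) : (Q : Matrix (Fin n) (Fin n) ℂ) *ᵥ w ≠ 0 := by
  intro h
  apply hw
  have h1 : star (Q : Matrix (Fin n) (Fin n) ℂ) * (Q : Matrix (Fin n) (Fin n) ℂ) = 1 :=
    Matrix.mem_unitaryGroup_iff'.mp Q.2
  have h2 := congrArg (fun v => star (Q : Matrix (Fin n) (Fin n) ℂ) *ᵥ v) h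
  simpa [Matrix.mulVec_mulVec, h1] using h2

open Polynomial in
/-- A hyperplane is hit with probability zero by the image of `w` under a Haar unitary, if almost
surely some coordinate occurring in its equation does not vanish. -/
theorem haarUnitary_hyperplane_of_ae {n : ℕ} (w c : Fin n → ℂ) (d : ℂ)
    (h : ∀ᵐ Q : Matrix.unitaryGroup (Fin n) ℂ ∂haarUnitary n,
      ∃ k, c k * ((Q : Matrix (Fin n) (Fin n) ℂ) *ᵥ w) k ≠ 0) :
    haarUnitary n {Q : Matrix.unitaryGroup (Fin n) ℂ |
      c ⬝ᵥ ((Q : Matrix (Fin n) (Fin n) ℂ) *ᵥ w) = d} = 0 := by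
  classical
  obtain ⟨z, hz⟩ : ∃ z : ℕ → Circle, Function.Injective z :=
    have : Infinite (Set.Ioc (-Real.pi) Real.pi) :=
      (Set.Ioc_infinite (by linarith [Real.pi_pos])).to_subtype
    have : Infinite Circle := Infinite.of_injective
      (fun t : Set.Ioc (-Real.pi) Real.pi => Circle.exp t) (fun a b hab => by
        have := congrArg (fun u : Circle => Complex.arg u) hab
        simp only [Circle.arg_exp a.2.1 a.2.2, Circle.arg_exp b.2.1 b.2.2] at this
        exact Subtype.ext this)
    ⟨Infinite.natEmbedding Circle, (Infinite.natEmbedding Circle).injective⟩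
  refine measure_eq_zero_of_bounded_overlap _ (measurableSet_hyperplane w c d)
    (fun i => powerDiagonal n (z i)) n ?_
  filter_upwards [h] with Q hQ s hs
  obtain ⟨k, hk⟩ := hQ
  set x := (Q : Matrix (Fin n) (Fin n) ℂ) *ᵥ w with hx
  -- Translating `Q` by `powerDiagonal n z` into the hyperplane means that `z` is a root of `p`. The
  -- exponents start at 1, so the constant `d` cannot cancel the coefficient that is known to be
  -- nonzero.
  set p : ℂ[X] := ∑ j : Fin n, C (c j * x j) * X ^ ((j : ℕ) + 1) - C d with hp
  have hcoeff : p.coeff ((k : ℕ) + 1) = c k * x k := by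
    rw [hp, coeff_sub, finsetSum_coeff, Finset.sum_eq_single k]
    · rw [coeff_C_mul_X_pow, if_pos rfl, coeff_C, if_neg (Nat.succ_ne_zero _), sub_zero]
    · intro j _ hj
      have : (k : ℕ) ≠ j := fun hkj => hj (Fin.ext hkj.symm)
      rw [coeff_C_mul_X_pow, if_neg (by omega)]
    · simp
  have hp0 : p ≠ 0 := fun h0 => hk (by rw [← hcoeff, h0, coeff_zero])
  have hdeg : p.natDegree ≤ n := by
    refine (natDegree_sub_le _ _).trans (max_le ?_ (by simp))
    refine natDegree_sum_le_of_forall_le _ _ fun j _ => ?_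
    exact (natDegree_C_mul_X_pow_le _ _).trans j.2
  have hroot : s.image (fun i => (z i : ℂ)) ⊆ p.roots.toFinset := by
    intro y hy
    obtain ⟨i, hi, rfl⟩ := Finset.mem_image.mp hy
    rw [Multiset.mem_toFinset, mem_roots hp0, IsRoot.def]
    have hi' : c ⬝ᵥ (((powerDiagonal n (z i) * Q : Matrix.unitaryGroup (Fin n) ℂ) :
        Matrix (Fin n) (Fin n) ℂ) *ᵥ w) = d := hs i hi
    rw [Submonoid.coe_mul, ← Matrix.mulVec_mulVec, ← hx] at hi'
    simp only [powerDiagonal, dotProduct, Matrix.mulVec_diagonal] at hi'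
    simp only [hp, eval_sub, eval_finsetSum, eval_mul, eval_C, eval_pow, eval_X]
    rw [← hi', sub_eq_zero]
    exact Finset.sum_congr rfl fun j _ => by ring
  calc s.card = (s.image fun i => (z i : ℂ)).card :=
        (Finset.card_image_of_injective _ fun a b hab => hz (Subtype.ext hab)).symm
    _ ≤ p.roots.toFinset.card := Finset.card_le_card hroot
    _ ≤ p.natDegree := (Multiset.toFinset_card_le _).trans (card_roots' p)
    _ ≤ n := hdeg

/-- The unitary matrix `1 - ((1 - i) / n) J`, with `J` the all-ones matrix: it has no zero entry. -/
noncomputable def fullUnitary (n : ℕ) : Matrix.unitaryGroup (Fin n) ℂ :=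
  ⟨1 - ((1 - Complex.I) / n) • Matrix.of fun _ _ => (1 : ℂ), by
    rcases Nat.eq_zero_or_pos n with rfl | hn
    · exact Matrix.mem_unitaryGroup_iff.mpr (Subsingleton.elim _ _)
    have hn' : (n : ℂ) ≠ 0 := by exact_mod_cast hn.ne'
    have hJJ : (Matrix.of fun _ _ => (1 : ℂ) : Matrix (Fin n) (Fin n) ℂ) *
        (Matrix.of fun _ _ => (1 : ℂ)) = (n : ℂ) • Matrix.of fun _ _ => (1 : ℂ) := by
      ext i j
      simp [Matrix.mul_apply]
    have hJs : star (Matrix.of fun _ _ => (1 : ℂ) : Matrix (Fin n) (Fin n) ℂ) =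
        Matrix.of fun _ _ => (1 : ℂ) := by
      ext i j
      simp [Matrix.star_apply]
    rw [Matrix.mem_unitaryGroup_iff, star_sub, star_smul, star_one, hJs, sub_mul, mul_sub, mul_sub,
      smul_mul_smul_comm, hJJ, one_mul, mul_one, one_mul, smul_smul]
    have : (1 - Complex.I) / n * star ((1 - Complex.I) / (n : ℂ)) * n =
        (1 - Complex.I) / n + star ((1 - Complex.I) / (n : ℂ)) := by
      simp only [star_div₀, star_sub, star_one, Complex.star_def, Complex.conj_I, map_natCast]
      field_simp
      ring_nf
      simp
      norm_num
    rw [this, add_smul]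
    abel⟩

theorem fullUnitary_apply_ne_zero {n : ℕ} (i j : Fin n) :
    (fullUnitary n : Matrix (Fin n) (Fin n) ℂ) i j ≠ 0 := by
  have hn : (n : ℝ) ≠ 0 := by exact_mod_cast (Fin.pos i).ne'
  intro h
  -- Every entry, on or off the diagonal, has imaginary part `1 / n`.
  have h1 := congrArg Complex.im h
  by_cases hij : i = j <;>
  simp [fullUnitary, hij, Complex.div_natCast_im] at h1 <;>
    exact hn (by exact_mod_cast h1)

/-- The image of a nonzero vector under a Haar unitary lies in a given hyperplane with probability
zero. -/
theorem haarUnitary_hyperplane {n : ℕ} {w c : Fin n → ℂ} (hw : w ≠ 0) (hc : c ≠ 0) (d : ℂ) :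
    haarUnitary n {Q : Matrix.unitaryGroup (Fin n) ℂ |
      c ⬝ᵥ ((Q : Matrix (Fin n) (Fin n) ℂ) *ᵥ w) = d} = 0 := by
  -- If no coefficient vanishes, the almost sure condition holds everywhere, because `Q *ᵥ w` is
  -- nonzero.
  have hfull : ∀ c' : Fin n → ℂ, (∀ k, c' k ≠ 0) →
      haarUnitary n {Q : Matrix.unitaryGroup (Fin n) ℂ |
        c' ⬝ᵥ ((Q : Matrix (Fin n) (Fin n) ℂ) *ᵥ w) = 0} = 0 := by
    intro c' hc'
    refine haarUnitary_hyperplane_of_ae w c' 0 (Filter.Eventually.of_forall fun Q => ?_)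
    obtain ⟨k, hk⟩ := Function.ne_iff.mp (unitary_mulVec_ne_zero Q hw)
    exact ⟨k, mul_ne_zero (hc' k) hk⟩
  obtain ⟨k, hk⟩ := Function.ne_iff.mp hc
  -- Left translation by `fullUnitary n` turns the vanishing of coordinate `k` into a hyperplane
  -- equation without zero coefficients, to which `hfull` applies.
  have hcoord : haarUnitary n {Q : Matrix.unitaryGroup (Fin n) ℂ |
      ((Q : Matrix (Fin n) (Fin n) ℂ) *ᵥ w) k = 0} = 0 := by
    have h1 := hfull (fun j => (fullUnitary n : Matrix (Fin n) (Fin n) ℂ) k j)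
      (fullUnitary_apply_ne_zero k)
    rw [← measure_preimage_mul (haarUnitary n) (fullUnitary n)]
    refine (congrArg (haarUnitary n) ?_).trans h1
    ext Q
    simp only [Set.mem_preimage, Set.mem_ofPred_eq, Submonoid.coe_mul, ← Matrix.mulVec_mulVec]
    rfl
  refine haarUnitary_hyperplane_of_ae w c d ?_
  have : ∀ᵐ Q : Matrix.unitaryGroup (Fin n) ℂ ∂haarUnitary n,
      ((Q : Matrix (Fin n) (Fin n) ℂ) *ᵥ w) k ≠ 0 := by
    rw [ae_iff]
    simpa using hcoord
  filter_upwards [this] with Q hQ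
  exact ⟨k, mul_ne_zero hk hQ⟩

/-! ### Displacements between QPSK symbols -/

/-- The real and imaginary parts of the QPSK symbols are plus or minus this number. -/
noncomputable def qpskAmp : ℝ := (Real.sqrt 2)⁻¹

theorem qpskAmp_pos : 0 < qpskAmp := by
  unfold qpskAmp
  positivity

theorem mem_qpsk_iff {z : ℂ} :
    z ∈ qpsk ↔ (z.re = qpskAmp ∨ z.re = -qpskAmp) ∧ (z.im = qpskAmp ∨ z.im = -qpskAmp) := by
  have h2 : ∀ a b : ℝ, (((a : ℂ) + (b : ℂ) * Complex.I) / ((Real.sqrt 2 : ℝ) : ℂ)) =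
      ⟨a * qpskAmp, b * qpskAmp⟩ := by
    intro a b
    apply Complex.ext
    · rw [Complex.div_ofReal_re]
      simp [qpskAmp, div_eq_mul_inv]
    · rw [Complex.div_ofReal_im]
      simp [qpskAmp, div_eq_mul_inv]
  constructor
  · rintro ⟨a, b, ha, hb, rfl⟩
    rw [h2]
    rcases ha with rfl | rfl <;> rcases hb with rfl | rfl <;> simp
  · rintro ⟨ha, hb⟩
    have key : ∀ x : ℝ, (x = qpskAmp ∨ x = -qpskAmp) → ∃ a : ℝ, (a = 1 ∨ a = -1) ∧
        x = a * qpskAmp := by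
      rintro x (rfl | rfl)
      · exact ⟨1, by simp⟩
      · exact ⟨-1, by simp⟩
    obtain ⟨a, ha1, ha2⟩ := key _ ha
    obtain ⟨b, hb1, hb2⟩ := key _ hb
    exact ⟨a, b, ha1, hb1, by rw [h2]; exact Complex.ext ha2 hb2⟩

/-- The QPSK constellation as a finite set. -/
noncomputable def qpskFinset : Finset ℂ := finite_qpsk.toFinset

theorem mem_qpskFinset {z : ℂ} : z ∈ qpskFinset ↔ z ∈ qpsk := by
  simp [qpskFinset]

theorem card_qpskFinset : qpskFinset.card = 4 := by
  have h : qpskFinset = (({qpskAmp, -qpskAmp} : Finset ℝ) ×ˢ ({qpskAmp, -qpskAmp} : Finset ℝ)).map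
      Complex.equivRealProd.symm.toEmbedding := by
    ext z
    rw [mem_qpskFinset, mem_qpsk_iff, Finset.mem_map_equiv]
    simp [Complex.equivRealProd]
  have hne : qpskAmp ≠ -qpskAmp := by linarith [qpskAmp_pos]
  rw [h, Finset.card_map, Finset.card_product, Finset.card_pair hne]

open Classical in
/-- The QPSK symbols that remain QPSK symbols when `z` is subtracted. -/
noncomputable def shiftable (z : ℂ) : Finset ℂ := qpskFinset.filter fun q => q - z ∈ qpsk

theorem mem_shiftable {z q : ℂ} : q ∈ shiftable z ↔ q ∈ qpsk ∧ q - z ∈ qpsk := by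
  classical
  rw [shiftable, Finset.mem_filter, mem_qpskFinset]

theorem card_shiftable_le_four (z : ℂ) : (shiftable z).card ≤ 4 := by
  classical
  exact (Finset.card_filter_le _ _).trans card_qpskFinset.le

theorem shiftable_zero : shiftable 0 = qpskFinset := by
  ext q
  simp [mem_shiftable, mem_qpskFinset]

/-- Both `q.re` and `q.re - z.re` are plus or minus the amplitude. If they differ, they are
opposite, so the displacement determines `q.re`. -/
theorem re_eq_half_of_mem_shiftable {z q : ℂ} (h : q ∈ shiftable z) (hz : z.re ≠ 0) :
    q.re = z.re / 2 := by
  obtain ⟨h1, h2⟩ := mem_shiftable.mp h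
  rw [mem_qpsk_iff] at h1 h2
  simp only [Complex.sub_re] at h2
  rcases h1.1 with h | h <;> rcases h2.1 with h' | h' <;>
    first | linarith | exact absurd (by linarith) hz

theorem im_eq_half_of_mem_shiftable {z q : ℂ} (h : q ∈ shiftable z) (hz : z.im ≠ 0) :
    q.im = z.im / 2 := by
  obtain ⟨h1, h2⟩ := mem_shiftable.mp h
  rw [mem_qpsk_iff] at h1 h2
  simp only [Complex.sub_im] at h2
  rcases h1.2 with h | h <;> rcases h2.2 with h' | h' <;>
    first | linarith | exact absurd (by linarith) hz

theorem card_shiftable_le_two {z : ℂ} (hz : z ≠ 0) : (shiftable z).card ≤ 2 := by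
  classical
  by_cases hre : z.re = 0
  · have him : z.im ≠ 0 := fun h => hz (Complex.ext hre h)
    have hsub : shiftable z ⊆ {⟨qpskAmp, z.im / 2⟩, ⟨-qpskAmp, z.im / 2⟩} := by
      intro q hq
      have h1 := (mem_qpsk_iff.mp (mem_shiftable.mp hq).1).1
      have h2 := im_eq_half_of_mem_shiftable hq him
      simpa [Complex.ext_iff, h2] using h1
    exact (Finset.card_le_card hsub).trans Finset.card_le_two
  · have hsub : shiftable z ⊆ {⟨z.re / 2, qpskAmp⟩, ⟨z.re / 2, -qpskAmp⟩} := by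
      intro q hq
      have h1 := (mem_qpsk_iff.mp (mem_shiftable.mp hq).1).2
      have h2 := re_eq_half_of_mem_shiftable hq hre
      simpa [Complex.ext_iff, h2] using h1
    exact (Finset.card_le_card hsub).trans Finset.card_le_two

theorem card_shiftable_le_one {z : ℂ} (hre : z.re ≠ 0) (him : z.im ≠ 0) :
    (shiftable z).card ≤ 1 := by
  refine Finset.card_le_one.mpr fun a ha b hb => Complex.ext ?_ ?_
  · rw [re_eq_half_of_mem_shiftable ha hre, re_eq_half_of_mem_shiftable hb hre]
  · rw [im_eq_half_of_mem_shiftable ha him, im_eq_half_of_mem_shiftable hb him]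

theorem mul_mem_qpsk {η q : ℂ} (hη : η.re = 0 ∧ (η.im = 1 ∨ η.im = -1)) (hq : q ∈ qpsk) :
    η * q ∈ qpsk := by
  rw [mem_qpsk_iff] at hq ⊢
  obtain ⟨h0, h1 | h1⟩ := hη <;> simp only [Complex.mul_re, Complex.mul_im, h0, h1] <;>
    obtain ⟨h | h, h' | h'⟩ := hq <;> simp [h, h']

theorem shiftable_mul_eq_empty {η z : ℂ} (hη : η.re = 0 ∧ (η.im = 1 ∨ η.im = -1))
    (h : shiftable z = ∅) : shiftable (η * z) = ∅ := by
  rw [Finset.eq_empty_iff_forall_notMem] at h ⊢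
  intro q hq
  have hη' : (-η).re = 0 ∧ ((-η).im = 1 ∨ (-η).im = -1) := by
    refine ⟨by simp [hη.1], ?_⟩
    rcases hη.2 with h | h <;> simp [h]
  have hηη : -η * η = 1 := by
    apply Complex.ext <;> rcases hη.2 with h | h <;> simp [hη.1, h]
  refine h (-η * q) (mem_shiftable.mpr ⟨mul_mem_qpsk hη' (mem_shiftable.mp hq).1, ?_⟩)
  have := mul_mem_qpsk hη' (mem_shiftable.mp hq).2
  rwa [mul_sub, ← mul_assoc, hηη, one_mul] at this

/-- A displacement that is possible and not parallel to an axis cannot be turned by 45 degrees and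
scaled up by `√2`. -/
theorem shiftable_diag_eq_empty {η z : ℂ} (hη : η.re = 0 ∧ (η.im = 1 ∨ η.im = -1))
    (h : (shiftable z).Nonempty) (hre : z.re ≠ 0) (him : z.im ≠ 0) :
    shiftable ((1 + η) * z) = ∅ := by
  rw [Finset.eq_empty_iff_forall_notMem]
  intro q hq
  obtain ⟨p, hp⟩ := h
  have h1 := re_eq_half_of_mem_shiftable hp hre
  have h2 := im_eq_half_of_mem_shiftable hp him
  have h3 := mem_qpsk_iff.mp (mem_shiftable.mp hp).1
  obtain ⟨h4, h5⟩ := mem_shiftable.mp hq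
  rw [mem_qpsk_iff] at h4 h5
  have hr := qpskAmp_pos
  rw [h1, h2] at h3
  obtain ⟨hη0, hη1 | hη1⟩ := hη <;>
    simp only [Complex.sub_re, Complex.sub_im, Complex.mul_re, Complex.mul_im, Complex.add_re,
      Complex.add_im, Complex.one_re, Complex.one_im, hη0, hη1] at h5 <;>
    obtain ⟨h3a | h3a, h3b | h3b⟩ := h3 <;> obtain ⟨h4a | h4a, h4b | h4b⟩ := h4 <;>
    obtain ⟨h5a | h5a, h5b | h5b⟩ := h5 <;> linarith

/-- For `z` on one axis, `η * z` lies on the other, so the diagonal displacement splits into two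
displacements acting on separate coordinates. -/
theorem mem_shiftable_diag_iff {η z q : ℂ} (hη : η.re = 0) (hz : z.re = 0 ∨ z.im = 0) :
    q ∈ shiftable ((1 + η) * z) ↔ q ∈ shiftable z ∧ q ∈ shiftable (η * z) := by
  simp only [mem_shiftable, mem_qpsk_iff, Complex.sub_re, Complex.sub_im, Complex.mul_re,
    Complex.mul_im, Complex.add_re, Complex.add_im, Complex.one_re, Complex.one_im, hη]
  rcases hz with hz | hz <;>
    simp only [hz, mul_zero, zero_mul, add_zero, zero_add, sub_zero, zero_sub, one_mul]
  · exact ⟨fun ⟨⟨a, b⟩, c, d⟩ => ⟨⟨⟨a, b⟩, a, d⟩, ⟨a, b⟩, c, b⟩,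
      fun ⟨⟨⟨a, b⟩, _, d⟩, _, c, _⟩ => ⟨⟨a, b⟩, c, d⟩⟩
  · exact ⟨fun ⟨⟨a, b⟩, c, d⟩ => ⟨⟨⟨a, b⟩, c, b⟩, ⟨a, b⟩, a, d⟩,
      fun ⟨⟨⟨a, b⟩, c, _⟩, _, _, d⟩ => ⟨⟨a, b⟩, c, d⟩⟩

theorem shiftable_diag_nonempty {η z : ℂ} (hη : η.re = 0 ∧ (η.im = 1 ∨ η.im = -1))
    (h : (shiftable z).Nonempty) (hz0 : z ≠ 0) (hz : z.re = 0 ∨ z.im = 0) :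
    (shiftable ((1 + η) * z)).Nonempty := by
  obtain ⟨p, hp⟩ := h
  obtain ⟨h1, -⟩ := mem_shiftable.mp hp
  rw [mem_qpsk_iff] at h1
  -- Half of the displacement is a symbol that the displacement sends to its negative.
  refine ⟨((1 + η) * z) / 2, mem_shiftable.mpr ?_⟩
  have hhalf : (1 + η) * z - (1 + η) * z / 2 = (1 + η) * z / 2 := by ring
  have hsym : ∀ q : ℂ, q ∈ qpsk → -q ∈ qpsk := by
    intro q hq
    rw [mem_qpsk_iff] at hq ⊢
    simp only [Complex.neg_re, Complex.neg_im, neg_eq_iff_eq_neg, neg_neg]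
    exact ⟨hq.1.symm, hq.2.symm⟩
  have hmem : (1 + η) * z / 2 ∈ qpsk := by
    have hre : ((1 + η) * z / 2).re = (z.re - η.im * z.im) / 2 := by simp [hη.1]
    have him : ((1 + η) * z / 2).im = (z.im + η.im * z.re) / 2 := by simp [hη.1]
    rw [mem_qpsk_iff, hre, him]
    rcases hz with hz | hz
    · have him : z.im ≠ 0 := fun h => hz0 (Complex.ext hz h)
      have h2 := im_eq_half_of_mem_shiftable hp him
      have h3 : z.im = 2 * p.im := by linarith
      rcases hη.2 with hi | hi <;> obtain ⟨-, h | h⟩ := h1 <;> simp only [hi, hz, h3, h] <;>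
        constructor <;> first | (left; linarith) | (right; linarith)
    · have hre : z.re ≠ 0 := fun h => hz0 (Complex.ext h hz)
      have h2 := re_eq_half_of_mem_shiftable hp hre
      have h3 : z.re = 2 * p.re := by linarith
      rcases hη.2 with hi | hi <;> obtain ⟨h | h, -⟩ := h1 <;> simp only [hi, hz, h3, h] <;>
        constructor <;> first | (left; linarith) | (right; linarith)
  refine ⟨hmem, ?_⟩
  rw [← neg_sub, hhalf]
  exact hsym _ hmem

/-- The three nonzero displacements away from a QPSK symbol. -/
theorem exists_displacements {c : ℂ} (hc : c ∈ qpsk) :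
    ∃ δ η : ℂ, δ ≠ 0 ∧ δ.im = 0 ∧ (η.re = 0 ∧ (η.im = 1 ∨ η.im = -1)) ∧
      ∀ z, z ≠ 0 → c - z ∈ qpsk → z = δ ∨ z = η * δ ∨ z = (1 + η) * δ := by
  have hr := qpskAmp_pos
  rw [mem_qpsk_iff] at hc
  -- `δ` flips the real part of `c`, `η * δ` the imaginary part, and their sum both. Thus `η` is
  -- `±i`, with the sign of `c.re * c.im`.
  refine ⟨⟨2 * c.re, 0⟩, ⟨0, c.re * c.im / qpskAmp ^ 2⟩, ?_, rfl, ⟨rfl, ?_⟩, ?_⟩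
  · intro h
    have := congrArg Complex.re h
    simp only [Complex.zero_re] at this
    obtain ⟨h | h, -⟩ := hc <;> linarith
  · obtain ⟨h | h, h' | h'⟩ := hc <;> simp only [h, h'] <;> field_simp <;> simp
  · intro z hz hcz
    rw [mem_qpsk_iff] at hcz
    simp only [Complex.sub_re, Complex.sub_im] at hcz
    have key : c.re * c.im / qpskAmp ^ 2 * (2 * c.re) = 2 * c.im := by
      obtain ⟨h | h, h' | h'⟩ := hc <;> simp only [h, h'] <;> field_simp
    have hre : z.re = 0 ∨ z.re = 2 * c.re := by
      obtain ⟨h | h, -⟩ := hc <;> obtain ⟨h' | h', -⟩ := hcz <;>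
        first | (left; linarith) | (right; linarith)
    have him : z.im = 0 ∨ z.im = 2 * c.im := by
      obtain ⟨-, h | h⟩ := hc <;> obtain ⟨-, h' | h'⟩ := hcz <;>
        first | (left; linarith) | (right; linarith)
    rcases hre with hre | hre <;> rcases him with him | him
    · exact absurd (Complex.ext hre him) hz
    · right; left
      apply Complex.ext <;> simp [hre, him, key]
    · left
      apply Complex.ext <;> simp [hre, him]
    · right; right
      apply Complex.ext <;> simp [hre, him, key]

/-! ### Counting the confusable vectors -/

/-- The vectors of QPSK symbols. -/
noncomputable def qpskVectors (D : ℕ) : Finset (Fin D → ℂ) := Fintype.piFinset fun _ => qpskFinset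

theorem mem_qpskVectors {D : ℕ} {s : Fin D → ℂ} : s ∈ qpskVectors D ↔ ∀ k, s k ∈ qpsk := by
  simp [qpskVectors, Fintype.mem_piFinset, mem_qpskFinset]

theorem card_qpskVectors (D : ℕ) : (qpskVectors D).card = 4 ^ D := by
  simp [qpskVectors, Fintype.card_piFinset, card_qpskFinset]

open Classical in
/-- The vectors of QPSK symbols that can be confused with another one along the direction `w`. -/
noncomputable def confusable {D : ℕ} (w : Fin D → ℂ) : Finset (Fin D → ℂ) :=
  (qpskVectors D).filter fun s => ∃ α : ℂ, α ≠ 0 ∧ ∀ k, s k - α * w k ∈ qpsk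

theorem mem_confusable {D : ℕ} {w s : Fin D → ℂ} :
    s ∈ confusable w ↔ (∀ k, s k ∈ qpsk) ∧ ∃ α : ℂ, α ≠ 0 ∧ ∀ k, s k - α * w k ∈ qpsk := by
  classical
  rw [confusable, Finset.mem_filter, mem_qpskVectors]

open Classical in
/-- The vectors with entry `c` at `k₀` that remain vectors of QPSK symbols, except possibly at `k₀`,
when `α * w` is subtracted. -/
noncomputable def shiftableFrom {D : ℕ} (w : Fin D → ℂ) (k₀ : Fin D) (c α : ℂ) :
    Finset (Fin D → ℂ) :=
  Fintype.piFinset fun k => if k = k₀ then {c} else shiftable (α * w k)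

/-- The number of ways to choose QPSK symbols at the zeros of `w`. -/
noncomputable def freeCount {D : ℕ} (w : Fin D → ℂ) : ℕ := ∏ k, if w k = 0 then 4 else 1

theorem prod_four_two {D : ℕ} (w : Fin D → ℂ) :
    (∏ k, if w k = 0 then 4 else 2) = freeCount w * 2 ^ hammingNorm w := by
  classical
  have h : (2 : ℕ) ^ hammingNorm w = ∏ k, if w k = 0 then 1 else 2 := by
    rw [Finset.prod_ite, Finset.prod_const_one, one_mul, Finset.prod_const, hammingNorm]
  rw [h, freeCount, ← Finset.prod_mul_distrib]
  exact Finset.prod_congr rfl fun k _ => by split_ifs <;> simp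

theorem freeCount_mul_four_pow {D : ℕ} (w : Fin D → ℂ) :
    freeCount w * 4 ^ hammingNorm w = 4 ^ D := by
  classical
  have h : (4 : ℕ) ^ hammingNorm w = ∏ k, if w k = 0 then 1 else 4 := by
    rw [Finset.prod_ite, Finset.prod_const_one, one_mul, Finset.prod_const, hammingNorm]
  rw [h, freeCount, ← Finset.prod_mul_distrib]
  calc _ = ∏ _k : Fin D, 4 := Finset.prod_congr rfl fun k _ => by split_ifs <;> simp
    _ = 4 ^ D := by simp

theorem card_shiftable_mul_le {D : ℕ} (w : Fin D → ℂ) {α : ℂ} (hα : α ≠ 0) (k : Fin D) :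
    (shiftable (α * w k)).card ≤ if w k = 0 then 4 else 2 := by
  split_ifs with h
  · exact card_shiftable_le_four _
  · exact card_shiftable_le_two (mul_ne_zero hα h)

/-- Each nonzero of `w` leaves at most two symbols, and prescribing the entry at `k₀` saves one
factor 2. -/
theorem card_shiftableFrom_le {D : ℕ} (w : Fin D → ℂ) (k₀ : Fin D) (hk₀ : w k₀ ≠ 0) (c : ℂ)
    {α : ℂ} (hα : α ≠ 0) :
    2 * (shiftableFrom w k₀ c α).card ≤ freeCount w * 2 ^ hammingNorm w := by
  classical
  have h2 : (2 : ℕ) = ∏ k, if k = k₀ then 2 else 1 := by simp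
  rw [shiftableFrom, Fintype.card_piFinset, ← prod_four_two]
  nth_rw 1 [h2]
  rw [← Finset.prod_mul_distrib]
  refine Finset.prod_le_prod' fun k _ => ?_
  by_cases hk : k = k₀
  · subst hk
    simp [hk₀]
  · simpa [hk] using card_shiftable_mul_le w hα k

/-- A displacement off both axes determines the symbol at `k₁`, which saves a second factor 2. -/
theorem card_shiftableFrom_le_of_diag {D : ℕ} (w : Fin D → ℂ) (k₀ k₁ : Fin D) (hk₀ : w k₀ ≠ 0)
    (hk : k₁ ≠ k₀) (c : ℂ) {α : ℂ} (hα : α ≠ 0) (hre : (α * w k₁).re ≠ 0)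
    (him : (α * w k₁).im ≠ 0) :
    4 * (shiftableFrom w k₀ c α).card ≤ freeCount w * 2 ^ hammingNorm w := by
  classical
  have h2 : ∀ l : Fin D, (2 : ℕ) = ∏ k, if k = l then 2 else 1 := by simp
  have hk₁ : w k₁ ≠ 0 := fun h => hre (by simp [h])
  have h4 : (4 : ℕ) = (∏ k, if k = k₀ then 2 else 1) * ∏ k, if k = k₁ then 2 else 1 := by
    rw [← h2, ← h2]
  rw [shiftableFrom, Fintype.card_piFinset, ← prod_four_two]
  nth_rw 1 [h4]
  rw [← Finset.prod_mul_distrib, ← Finset.prod_mul_distrib]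
  refine Finset.prod_le_prod' fun k _ => ?_
  by_cases hkk : k = k₀
  · subst hkk
    simp [hk₀, hk.symm]
  · by_cases hkk' : k = k₁
    · subst hkk'
      have := card_shiftable_le_one hre him
      simp only [hk, hk₁, if_true, if_false]
      omega
    · simpa [hkk, hkk'] using card_shiftable_mul_le w hα k

theorem shiftableFrom_eq_empty {D : ℕ} {w : Fin D → ℂ} {k₀ k : Fin D} (hk : k ≠ k₀) {c α : ℂ}
    (h : shiftable (α * w k) = ∅) : shiftableFrom w k₀ c α = ∅ := by
  classical
  rw [Finset.eq_empty_iff_forall_notMem] at h ⊢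
  intro s hs
  have := Fintype.mem_piFinset.mp hs k
  rw [if_neg hk] at this
  exact h _ this

/-- At most `(2 ^ L - 1) 4 ^ (D - L)` vectors with a given entry at `k₀` are confusable along a
vector with `L` nonzero entries, `k₀` among them. -/
theorem card_confusable_fiber {D : ℕ} (w : Fin D → ℂ) (k₀ : Fin D) (hk₀ : w k₀ ≠ 0) {c : ℂ}
    (hc : c ∈ qpsk) :
    ((confusable w).filter fun s => s k₀ = c).card + freeCount w ≤
      freeCount w * 2 ^ hammingNorm w := by
  classical
  obtain ⟨δ, η, hδ, hδim, hη, hdisp⟩ := exists_displacements hc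
  have hη0 : η ≠ 0 := by
    rintro rfl
    simp at hη
  have hη1 : 1 + η ≠ 0 := by
    intro h
    have := congrArg Complex.re h
    simp [hη.1] at this
  set α := δ / w k₀ with hαdef
  have hα : α ≠ 0 := div_ne_zero hδ hk₀
  have hαw : α * w k₀ = δ := div_mul_cancel₀ δ hk₀
  have hcover : (confusable w).filter (fun s => s k₀ = c) ⊆
      shiftableFrom w k₀ c α ∪ shiftableFrom w k₀ c (η * α) ∪
        shiftableFrom w k₀ c ((1 + η) * α) := by
    intro s hs
    obtain ⟨hs, hsc⟩ := Finset.mem_filter.mp hs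
    obtain ⟨hq, β, hβ, hsβ⟩ := mem_confusable.mp hs
    have hmem : s ∈ shiftableFrom w k₀ c β := by
      refine Fintype.mem_piFinset.mpr fun k => ?_
      split_ifs with hk
      · rw [hk, hsc]
        exact Finset.mem_singleton_self c
      · exact mem_shiftable.mpr ⟨hq k, hsβ k⟩
    have hz := hdisp (β * w k₀) (mul_ne_zero hβ hk₀) (hsc ▸ hsβ k₀)
    have hcancel : ∀ γ : ℂ, β * w k₀ = γ * δ → β = γ * α := by
      intro γ h
      apply mul_right_cancel₀ hk₀
      rw [h, mul_assoc, hαw]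
    simp only [Finset.mem_union]
    rcases hz with h | h | h
    · have := hcancel 1 (by rw [h, one_mul])
      rw [one_mul] at this
      exact Or.inl (Or.inl (this ▸ hmem))
    · exact Or.inl (Or.inr (hcancel _ h ▸ hmem))
    · exact Or.inr (hcancel _ h ▸ hmem)
  have hcard := Finset.card_le_card hcover
  have hL : 1 ≤ hammingNorm w := by
    rw [Nat.one_le_iff_ne_zero, hammingNorm_ne_zero_iff]
    exact fun h => hk₀ (by rw [h]; rfl)
  have htwo : freeCount w * 2 ≤ freeCount w * 2 ^ hammingNorm w :=
    Nat.mul_le_mul_left _ (by simpa using Nat.pow_le_pow_right (n := 2) (by norm_num) hL)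
  -- Some `α * w k` is no displacement between symbols. Neither is its quarter turn, so only the
  -- scaling by `(1 + η) * α` survives.
  by_cases hA : ∃ k, k ≠ k₀ ∧ shiftable (α * w k) = ∅
  · obtain ⟨k, hk, hempty⟩ := hA
    rw [shiftableFrom_eq_empty hk hempty, shiftableFrom_eq_empty hk (α := η * α)
      (by rw [mul_assoc]; exact shiftable_mul_eq_empty hη hempty), Finset.empty_union,
      Finset.empty_union] at hcard
    have := card_shiftableFrom_le w k₀ hk₀ c (mul_ne_zero hη1 hα)
    omega
  push Not at hA
  have hne : ∀ k, k ≠ k₀ → (shiftable (α * w k)).Nonempty := hA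
  -- Some `α * w k` is off both axes. The diagonal scaling is then impossible, and each of the other
  -- two is restricted twice, at `k₀` and at `k`.
  by_cases hB : ∃ k, (α * w k).re ≠ 0 ∧ (α * w k).im ≠ 0
  · obtain ⟨k, hre, him⟩ := hB
    have hk : k ≠ k₀ := by
      rintro rfl
      exact him (by rw [hαw, hδim])
    rw [shiftableFrom_eq_empty hk (α := (1 + η) * α)
      (by rw [mul_assoc]; exact shiftable_diag_eq_empty hη (hne k hk) hre him),
      Finset.union_empty] at hcard
    have hηim : η.im ≠ 0 := by rcases hη.2 with h | h <;> simp [h]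
    have h1 := card_shiftableFrom_le_of_diag w k₀ k hk₀ hk c hα hre him
    have h2 := card_shiftableFrom_le_of_diag w k₀ k hk₀ hk c (α := η * α) (mul_ne_zero hη0 hα)
      (by rw [mul_assoc, Complex.mul_re, hη.1]; simpa using ⟨hηim, him⟩)
      (by rw [mul_assoc, Complex.mul_im, hη.1]; simpa using ⟨hηim, hre⟩)
    have h3 := Finset.card_union_le (shiftableFrom w k₀ c α) (shiftableFrom w k₀ c (η * α))
    omega
  push Not at hB
  have haxis : ∀ k, (α * w k).re = 0 ∨ (α * w k).im = 0 := fun k => by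
    by_cases h : (α * w k).re = 0
    · exact Or.inl h
    · exact Or.inr (hB k h)
  -- All displacements lie on the axes: the diagonal set is the intersection of the other two and
  -- has at least `freeCount w` elements, which inclusion-exclusion subtracts.
  have hinter : shiftableFrom w k₀ c ((1 + η) * α) =
      shiftableFrom w k₀ c α ∩ shiftableFrom w k₀ c (η * α) := by
    ext s
    simp only [shiftableFrom, Finset.mem_inter, Fintype.mem_piFinset, ← forall_and]
    refine forall_congr' fun k => ?_
    split_ifs with hk
    · simp
    · rw [mul_assoc, mul_assoc, mem_shiftable_diag_iff hη.1 (haxis k)]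
  have hfree : freeCount w ≤ (shiftableFrom w k₀ c ((1 + η) * α)).card := by
    rw [shiftableFrom, Fintype.card_piFinset, freeCount]
    refine Finset.prod_le_prod' fun k _ => ?_
    by_cases hk : k = k₀
    · subst hk
      simp [hk₀]
    · rw [if_neg hk]
      split_ifs with hw
      · rw [hw, mul_zero, shiftable_zero, card_qpskFinset]
      · rw [Nat.one_le_iff_ne_zero, Finset.card_ne_zero, mul_assoc]
        exact shiftable_diag_nonempty hη (hne k hk) (mul_ne_zero hα hw) (haxis k)
  rw [hinter] at hcard hfree
  rw [Finset.union_eq_left.mpr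
    (Finset.inter_subset_left.trans Finset.subset_union_left)] at hcard
  have h1 := card_shiftableFrom_le w k₀ hk₀ c hα
  have h2 := card_shiftableFrom_le w k₀ hk₀ c (mul_ne_zero hη0 hα)
  have h3 := Finset.card_union_add_card_inter (shiftableFrom w k₀ c α)
    (shiftableFrom w k₀ c (η * α))
  omega

/-- Adding the fibers over the four symbols at `k₀` gives at most `4 * freeCount w * (2 ^ L - 1)`
vectors, and `freeCount w` is `4 ^ (D - L)`. -/
theorem card_confusable_le {D : ℕ} {w : Fin D → ℂ} (hw : w ≠ 0) :
    ((confusable w).card : ℝ) / 4 ^ D ≤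
      ((2 : ℝ) ^ hammingNorm w - 1) / 4 ^ (hammingNorm w - 1) := by
  classical
  obtain ⟨k₀, hk₀⟩ := Function.ne_iff.mp hw
  have hsum : (confusable w).card =
      ∑ c ∈ qpskFinset, ((confusable w).filter fun s => s k₀ = c).card :=
    Finset.card_eq_sum_card_fiberwise fun s hs =>
      mem_qpskFinset.mpr ((mem_confusable.mp hs).1 k₀)
  have h1 : (confusable w).card + 4 * freeCount w ≤ 4 * (freeCount w * 2 ^ hammingNorm w) := by
    have h2 : ∑ c ∈ qpskFinset, (((confusable w).filter fun s => s k₀ = c).card + freeCount w) ≤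
        ∑ _c ∈ qpskFinset, freeCount w * 2 ^ hammingNorm w :=
      Finset.sum_le_sum fun c hc => card_confusable_fiber w k₀ hk₀ (mem_qpskFinset.mp hc)
    rwa [Finset.sum_add_distrib, ← hsum, Finset.sum_const, Finset.sum_const, card_qpskFinset,
      smul_eq_mul, smul_eq_mul] at h2
  have h1' : ((confusable w).card : ℝ) + 4 * freeCount w ≤
      4 * (freeCount w * 2 ^ hammingNorm w) := by exact_mod_cast h1
  have h3 : (freeCount w : ℝ) * 4 ^ hammingNorm w = 4 ^ D := by
    exact_mod_cast freeCount_mul_four_pow w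
  obtain ⟨L, hL⟩ : ∃ L, hammingNorm w = L + 1 :=
    Nat.exists_eq_succ_of_ne_zero (hammingNorm_ne_zero_iff.mpr hw)
  rw [hL] at h1' h3 ⊢
  rw [Nat.add_sub_cancel, ← h3, div_le_div_iff₀ (by rw [h3]; positivity) (by positivity)]
  have h4 := mul_le_mul_of_nonneg_right h1' (by positivity : (0 : ℝ) ≤ 4 ^ L)
  rw [pow_succ (4 : ℝ) L]
  linarith

/-! ### What eclipsing implies for random pilots -/

theorem pinv_smul_unitary {n : ℕ} (Q : Matrix.unitaryGroup (Fin n) ℂ) {a : ℝ} (ha : a ≠ 0) :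
    pinv ((a : ℂ) • (Q : Matrix (Fin n) (Fin n) ℂ)) =
      (a : ℂ)⁻¹ • (Q : Matrix (Fin n) (Fin n) ℂ)ᴴ := by
  have ha' : (a : ℂ) ≠ 0 := by exact_mod_cast ha
  have hQ : (Q : Matrix (Fin n) (Fin n) ℂ) * (Q : Matrix (Fin n) (Fin n) ℂ)ᴴ = 1 :=
    Matrix.mem_unitaryGroup_iff.mp Q.2
  have h1 : (((a : ℂ) • (Q : Matrix (Fin n) (Fin n) ℂ)) *
      ((a : ℂ) • (Q : Matrix (Fin n) (Fin n) ℂ))ᴴ)⁻¹ = ((a : ℂ)⁻¹ * (a : ℂ)⁻¹) • 1 := by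
    apply Matrix.inv_eq_right_inv
    rw [Matrix.conjTranspose_smul, smul_mul_smul_comm, hQ, smul_mul_smul_comm, one_mul]
    simp only [Complex.star_def, Complex.conj_ofReal]
    rw [show (a : ℂ) * a * ((a : ℂ)⁻¹ * (a : ℂ)⁻¹) = 1 by field_simp, one_smul]
  rw [pinv, h1, Matrix.conjTranspose_smul, smul_mul_smul_comm, mul_one]
  congr 1
  simp only [Complex.star_def, Complex.conj_ofReal]
  field_simp

theorem measurable_smul_unitary {n : ℕ} (a : ℂ) :
    Measurable fun Q : Matrix.unitaryGroup (Fin n) ℂ => a • (Q : Matrix (Fin n) (Fin n) ℂ) := by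
  have h : Continuous fun Q : Matrix.unitaryGroup (Fin n) ℂ =>
      a • (Q : Matrix (Fin n) (Fin n) ℂ) := continuous_subtype_val.const_smul a
  exact h.measurable

/-- The pilot law puts no mass on the pilots for which the estimated jammer interference
`wT * pinv ST` lies in a given hyperplane. -/
theorem ae_pilotLaw_hyperplane {U : ℕ} {w c : Fin U → ℂ} (hw : w ≠ 0) (hc : c ≠ 0) (d : ℂ) :
    ∀ᵐ ST ∂pilotLaw U, (rowMatrix w * pinv ST) 0 ⬝ᵥ c ≠ d := by
  have hU : 0 < U := by
    obtain ⟨k, -⟩ := Function.ne_iff.mp hw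
    exact Fin.pos k
  have hsqrt : Real.sqrt U ≠ 0 := (Real.sqrt_pos.mpr (by exact_mod_cast hU)).ne'
  have hf : Measurable fun Q : Matrix.unitaryGroup (Fin U) ℂ =>
      ((Real.sqrt U : ℝ) : ℂ) • (Q : Matrix (Fin U) (Fin U) ℂ) :=
    measurable_smul_unitary _
  have hm : MeasurableSet {ST : Matrix (Fin U) (Fin U) ℂ |
      (rowMatrix w * pinv ST) 0 ⬝ᵥ c ≠ d} := by
    refine (measurableSet_eq_fun ?_ measurable_const).compl
    simp only [dotProduct, Matrix.mul_apply]
    have hp : ∀ a b, Measurable fun ST : Matrix (Fin U) (Fin U) ℂ => pinv ST a b := fun a b =>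
      (measurable_matrix_entry a b).comp (measurable_pinv U U)
    fun_prop
  rw [pilotLaw, ae_map_iff hf.aemeasurable hm, ae_iff]
  have hw' : star w ≠ 0 := by simpa using hw
  have hc' : star c ≠ 0 := by simpa using hc
  -- For `ST = √U • Q` the estimate is `w` times `Qᴴ / √U`. Conjugating the equation makes it linear
  -- in `Q *ᵥ star w`.
  refine measure_mono_null ?_
    (haarUnitary_hyperplane hw' hc' (((Real.sqrt U : ℝ) : ℂ) * star d))
  intro Q hQ
  have hQ' : (rowMatrix w * pinv (((Real.sqrt U : ℝ) : ℂ) • (Q : Matrix (Fin U) (Fin U) ℂ))) 0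
      ⬝ᵥ c = d := by simpa using hQ
  have hs : ((Real.sqrt U : ℝ) : ℂ) ≠ 0 := by exact_mod_cast hsqrt
  rw [pinv_smul_unitary Q hsqrt] at hQ'
  show star c ⬝ᵥ ((Q : Matrix (Fin U) (Fin U) ℂ) *ᵥ star w) = _
  rw [← hQ']
  simp only [dotProduct, Matrix.mulVec, Matrix.mul_apply, rowMatrix, Matrix.replicateRow_apply,
    Matrix.smul_apply, Matrix.conjTranspose_apply, smul_eq_mul, star_sum, star_mul', star_star,
    Finset.mul_sum, Finset.sum_mul, Pi.star_apply, star_inv₀]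
  refine Finset.sum_congr rfl fun i _ => Finset.sum_congr rfl fun j _ => ?_
  simp only [Complex.star_def, Complex.conj_ofReal]
  field_simp

/-- The nonzero row `S u₀ - S' u₀` spans the row space, so only minors containing it are needed. -/
theorem minors_of_eclipsed {U D : ℕ} {ST : Matrix (Fin U) (Fin U) ℂ}
    {S : Matrix (Fin U) (Fin D) ℂ} {wT : Fin U → ℂ} {wD : Fin D → ℂ}
    (h : Eclipsed ST S (rowMatrix wT) (rowMatrix wD)) :
    ∃ S' ∈ dataMatrices U D, ∃ u₀, S u₀ ≠ S' u₀ ∧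
      (∀ u k l, (S u k - S' u k) * (S u₀ l - S' u₀ l) = (S u l - S' u l) * (S u₀ k - S' u₀ k)) ∧
      ∀ k l, (wD k - (rowMatrix wT * pinv ST) 0 ⬝ᵥ fun u => S' u k) * (S u₀ l - S' u₀ l) =
        (wD l - (rowMatrix wT * pinv ST) 0 ⬝ᵥ fun u => S' u l) * (S u₀ k - S' u₀ k) := by
  obtain ⟨S', hS', hne, hrank⟩ := h
  rw [rank_le_one_iff_minors] at hrank
  obtain ⟨u₀, hu₀⟩ := Function.ne_iff.mp hne.symm
  refine ⟨S', hS', u₀, hu₀, fun u k l => ?_, fun k l => ?_⟩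
  · exact hrank (Sum.inl u) (Sum.inl u₀) k l
  · exact hrank (Sum.inr 0) (Sum.inl u₀) k l

/-- With `wT = 0` the jammer row is `wD`, independent of the candidate, and a nonzero row of `S -
S'` must be a nonzero multiple of it. -/
theorem eclipsed_silent {U D : ℕ} {ST : Matrix (Fin U) (Fin U) ℂ}
    {S : Matrix (Fin U) (Fin D) ℂ} {wD : Fin D → ℂ} (hwD : wD ≠ 0) (hS : S ∈ dataMatrices U D)
    (h : Eclipsed ST S (rowMatrix 0) (rowMatrix wD)) : ∃ u, S u ∈ confusable wD := by
  obtain ⟨S', hmem, u, hu, -, hrow⟩ := minors_of_eclipsed h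
  have h0 : (rowMatrix (0 : Fin U → ℂ)) = 0 := rfl
  simp only [h0, Matrix.zero_mul] at hrow
  have hz : ∀ x : Fin U → ℂ, (0 : Matrix (Fin 1) (Fin U) ℂ) 0 ⬝ᵥ x = 0 := fun x =>
    zero_dotProduct x
  simp only [hz, sub_zero] at hrow
  obtain ⟨l, hl⟩ := Function.ne_iff.mp hwD
  have hl' : wD l ≠ 0 := hl
  have hα : ∀ k, S u k - S' u k = (S u l - S' u l) / wD l * wD k := by
    intro k
    rw [div_mul_eq_mul_div, eq_div_iff hl']
    linear_combination hrow l k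
  refine ⟨u, mem_confusable.mpr ⟨hS u, (S u l - S' u l) / wD l, ?_, fun k => ?_⟩⟩
  · intro hzero
    refine hu (funext fun k => sub_eq_zero.mp ?_)
    rw [hα k, hzero, zero_mul]
  · rw [← hα k, sub_sub_cancel]
    exact hmem u k

/-- All rows of the data matrix and the jammer signal are multiples of a common vector. -/
def Collinear {U D : ℕ} (wD : Fin D → ℂ) (S : Matrix (Fin U) (Fin D) ℂ) : Prop :=
  ∃ (e : Fin D → ℂ) (l : Fin D), e l ≠ 0 ∧ (∀ u k, S u k * e l = S u l * e k) ∧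
    ∀ k, wD k * e l = wD l * e k

/-- For fixed `S` and `S'` a jammer-row minor is an affine equation in `wT * pinv ST`. Off a null
set of pilots it holds only with zero coefficients. These say that the rows of `S'` are parallel to
`e = S u₀ - S' u₀`, hence so are those of `S`, and what remains of the equation says the same of
`wD`. -/
theorem ae_collinear_of_eclipsed {U D : ℕ} {wT : Fin U → ℂ} (hwT : wT ≠ 0) (wD : Fin D → ℂ) :
    ∀ᵐ ST ∂pilotLaw U, ∀ S ∈ dataMatrices U D,
      Eclipsed ST S (rowMatrix wT) (rowMatrix wD) → Collinear wD S := by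
  have hae : ∀ᵐ ST ∂pilotLaw U, ∀ S ∈ dataMatrices U D, ∀ S' ∈ dataMatrices U D, ∀ u₀ k l,
      (fun u => S' u k * (S u₀ l - S' u₀ l) - S' u l * (S u₀ k - S' u₀ k)) ≠ 0 →
      (rowMatrix wT * pinv ST) 0 ⬝ᵥ
        (fun u => S' u k * (S u₀ l - S' u₀ l) - S' u l * (S u₀ k - S' u₀ k)) ≠
        wD k * (S u₀ l - S' u₀ l) - wD l * (S u₀ k - S' u₀ k) := by
    have hcount := (finite_dataMatrices U D).countable
    refine (ae_ball_iff hcount).mpr fun S _ => (ae_ball_iff hcount).mpr fun S' _ => ?_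
    simp only [ae_all_iff]
    intro u₀ k l hne
    exact ae_pilotLaw_hyperplane hwT hne _
  filter_upwards [hae] with ST hST S hS hecl
  obtain ⟨S', hS', u₀, hu₀, hrows, hlast⟩ := minors_of_eclipsed hecl
  obtain ⟨l, hl⟩ := Function.ne_iff.mp hu₀
  have hdot : ∀ k, (rowMatrix wT * pinv ST) 0 ⬝ᵥ
        (fun u => S' u k * (S u₀ l - S' u₀ l) - S' u l * (S u₀ k - S' u₀ k)) =
        wD k * (S u₀ l - S' u₀ l) - wD l * (S u₀ k - S' u₀ k) := by
    intro k
    have h1 : (fun u => S' u k * (S u₀ l - S' u₀ l) - S' u l * (S u₀ k - S' u₀ k)) =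
        (S u₀ l - S' u₀ l) • (fun u => S' u k) - (S u₀ k - S' u₀ k) • fun u => S' u l := by
      funext u
      simp only [Pi.sub_apply, Pi.smul_apply, smul_eq_mul]
      ring
    rw [h1, dotProduct_sub, dotProduct_smul, dotProduct_smul, smul_eq_mul, smul_eq_mul]
    linear_combination -hlast k l
  have hzero : ∀ k, (fun u => S' u k * (S u₀ l - S' u₀ l) - S' u l * (S u₀ k - S' u₀ k)) = 0 := by
    intro k
    by_contra hne
    exact hST S hS S' hS' u₀ k l hne (hdot k)
  refine ⟨fun k => S u₀ k - S' u₀ k, l, sub_ne_zero.mpr hl, fun u k => ?_, fun k => ?_⟩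
  · have h1 := congrFun (hzero k) u
    simp only [Pi.zero_apply] at h1
    linear_combination hrows u k l + h1
  · have h1 := hdot k
    rw [hzero k, dotProduct_zero] at h1
    linear_combination -h1

theorem Collinear.minors {U D : ℕ} {wD : Fin D → ℂ} {S : Matrix (Fin U) (Fin D) ℂ}
    (h : Collinear wD S) (u v : Fin U) (k l : Fin D) : S u k * S v l = S u l * S v k := by
  obtain ⟨e, j, hj, hS, -⟩ := h
  have hS' : ∀ u k, S u k = S u j / e j * e k := fun u k => by
    rw [div_mul_eq_mul_div, eq_div_iff hj, hS]
  rw [hS' u k, hS' v l, hS' u l, hS' v k]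
  ring

theorem Collinear.minors_jammer {U D : ℕ} {wD : Fin D → ℂ} {S : Matrix (Fin U) (Fin D) ℂ}
    (h : Collinear wD S) (u : Fin U) (k l : Fin D) : S u k * wD l = S u l * wD k := by
  obtain ⟨e, j, hj, hS, hw⟩ := h
  have hS' : ∀ k, S u k = S u j / e j * e k := fun k => by
    rw [div_mul_eq_mul_div, eq_div_iff hj, hS]
  have hw' : ∀ k, wD k = wD j / e j * e k := fun k => by
    rw [div_mul_eq_mul_div, eq_div_iff hj, hw]
  rw [hS' k, hS' l, hw' k, hw' l]
  ring

theorem ne_zero_of_mem_qpsk {z : ℂ} (h : z ∈ qpsk) : z ≠ 0 := by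
  rintro rfl
  have hr := qpskAmp_pos
  obtain ⟨h | h, -⟩ := mem_qpsk_iff.mp h <;> simp only [Complex.zero_re] at h <;> linarith

/-! ### Counting the collinear data matrices -/

/-- The data matrices as a finite set. -/
noncomputable def dataFinset (U D : ℕ) : Finset (Matrix (Fin U) (Fin D) ℂ) :=
  Fintype.piFinset fun _ : Fin U => qpskVectors D

theorem mem_dataFinset {U D : ℕ} {S : Matrix (Fin U) (Fin D) ℂ} :
    S ∈ dataFinset U D ↔ S ∈ dataMatrices U D :=
  Fintype.mem_piFinset.trans (forall_congr' fun _ => mem_qpskVectors)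

theorem coe_dataFinset (U D : ℕ) :
    (dataFinset U D : Set (Matrix (Fin U) (Fin D) ℂ)) = dataMatrices U D :=
  Set.ext fun _ => mem_dataFinset

theorem card_dataFinset (U D : ℕ) : (dataFinset U D).card = (4 ^ D) ^ U := by
  refine (Fintype.card_piFinset _).trans ?_
  simp [card_qpskVectors]

/-- A set of data matrices each of which is determined by the other rows and one entry of the row
`v` contains at most a fraction `1 / 4 ^ (D - 1)` of all data matrices. -/
theorem card_mul_four_pow_le {U D : ℕ} {B : Finset (Matrix (Fin U) (Fin D) ℂ)}
    (hB : B ⊆ dataFinset U D) (v : Fin U) (l : Fin D)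
    (h : ∀ S ∈ B, ∀ S' ∈ B, (∀ u, u ≠ v → S u = S' u) → S v l = S' v l → S v = S' v) :
    B.card * 4 ^ (D - 1) ≤ (4 ^ D) ^ U := by
  classical
  obtain ⟨q, hq⟩ : qpskFinset.Nonempty := by
    rw [← Finset.card_ne_zero, card_qpskFinset]
    norm_num
  -- `f` overwrites row `v`, except at `l`, by a fixed symbol. By hypothesis this loses no
  -- information on `B`, while its values leave only one free symbol in that row.
  let f : Matrix (Fin U) (Fin D) ℂ → (Fin U → Fin D → ℂ) := fun S u =>
    if u = v then fun k => if k = l then S v l else q else S u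
  let T : Finset (Fin U → Fin D → ℂ) := Fintype.piFinset fun u =>
    if u = v then Fintype.piFinset fun k => if k = l then qpskFinset else {q} else qpskVectors D
  have hcard : B.card ≤ T.card := by
    refine Finset.card_le_card_of_injOn f ?_ ?_
    · intro S hS
      have hS' := mem_dataFinset.mp (hB hS)
      refine Fintype.mem_piFinset.mpr fun u => ?_
      by_cases hu : u = v
      · simp only [f, hu, if_true]
        refine Fintype.mem_piFinset.mpr fun k => ?_
        by_cases hk : k = l
        · simpa only [hk, if_true] using mem_qpskFinset.mpr (hS' v l)
        · simp [hk]
      · simpa only [f, hu, if_false] using mem_qpskVectors.mpr (hS' u)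
    · intro S hS S' hS' hff
      have hoff : ∀ u, u ≠ v → S u = S' u := fun u hu => by
        simpa only [f, hu, if_false] using congrFun hff u
      have hl : S v l = S' v l := by
        simpa only [f, if_true] using congrFun (congrFun hff v) l
      refine funext fun u => ?_
      by_cases hu : u = v
      · rw [hu]
        exact h S hS S' hS' hoff hl
      · exact hoff u hu
  have hT : T.card * 4 ^ (D - 1) = (4 ^ D) ^ U := by
    have h1 : ∀ u, (if u = v then Fintype.piFinset fun k : Fin D =>
        if k = l then qpskFinset else {q} else qpskVectors D).card =
        if u = v then 4 else 4 ^ D := by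
      intro u
      split_ifs
      · rw [Fintype.card_piFinset]
        have : ∀ k, (if k = l then qpskFinset else {q}).card = if k = l then 4 else 1 := by
          intro k
          split_ifs <;> simp [card_qpskFinset]
        simp [this]
      · exact card_qpskVectors D
    have h2 : (4 : ℕ) ^ (D - 1) = ∏ u, if u = v then 4 ^ (D - 1) else 1 := by simp
    rw [Fintype.card_piFinset]
    simp only [h1]
    rw [h2, ← Finset.prod_mul_distrib]
    have h3 : ∀ u : Fin U, ((if u = v then 4 else 4 ^ D) * if u = v then 4 ^ (D - 1) else 1) =
        4 ^ D := by
      intro u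
      split_ifs
      · rw [← pow_succ', Nat.sub_add_cancel (Fin.pos l)]
      · simp
    simp [h3]
  calc B.card * 4 ^ (D - 1) ≤ T.card * 4 ^ (D - 1) := Nat.mul_le_mul_right _ hcard
    _ = _ := hT

/-- With a second row, row 1 is a multiple of row 0, whose entries are nonzero, so one entry fixes
it. With `wD ≠ 0`, row 0 is a multiple of `wD` and is fixed by its entry at a nonzero of `wD`. -/
theorem card_collinear_le {U D : ℕ} (hU : 0 < U) (hD : 0 < D) {wD : Fin D → ℂ}
    (h : 2 ≤ U ∨ wD ≠ 0) {B : Finset (Matrix (Fin U) (Fin D) ℂ)} (hB : B ⊆ dataFinset U D)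
    (hcol : ∀ S ∈ B, Collinear wD S) : B.card * 4 ^ (D - 1) ≤ (4 ^ D) ^ U := by
  rcases h with hU2 | hw
  · refine card_mul_four_pow_le hB ⟨1, hU2⟩ ⟨0, hD⟩ fun S hS S' hS' hoff hl => funext fun k => ?_
    have h0 := hoff ⟨0, hU⟩ (by simp)
    have h1 := (hcol S hS).minors ⟨1, hU2⟩ ⟨0, hU⟩ k ⟨0, hD⟩
    have h2 := (hcol S' hS').minors ⟨1, hU2⟩ ⟨0, hU⟩ k ⟨0, hD⟩
    rw [h0, hl, ← h2] at h1
    exact mul_right_cancel₀ (ne_zero_of_mem_qpsk (mem_dataFinset.mp (hB hS') _ _)) h1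
  · obtain ⟨l, hl⟩ := Function.ne_iff.mp hw
    refine card_mul_four_pow_le hB ⟨0, hU⟩ l fun S hS S' hS' _ hl' => funext fun k => ?_
    have h1 := (hcol S hS).minors_jammer ⟨0, hU⟩ k l
    rw [hl', ← (hcol S' hS').minors_jammer ⟨0, hU⟩ k l] at h1
    exact mul_right_cancel₀ hl h1

theorem uniformOn_dataMatrices_real {U D : ℕ} {B : Finset (Matrix (Fin U) (Fin D) ℂ)}
    (hB : B ⊆ dataFinset U D) :
    (uniformOn (dataMatrices U D)).real B = (B.card : ℝ) / (4 ^ D) ^ U := by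
  classical
  rw [measureReal_def, ← coe_dataFinset, uniformOn_apply_finset, Finset.inter_eq_right.mpr hB,
    card_dataFinset, ENNReal.toReal_div]
  simp

instance uniformOn_dataMatrices_isProbabilityMeasure (U D : ℕ) :
    IsProbabilityMeasure (uniformOn (dataMatrices U D)) := by
  refine isProbabilityMeasure_uniformOn (finite_dataMatrices U D) ?_
  rw [← coe_dataFinset, Finset.coe_nonempty, ← Finset.card_pos, card_dataFinset]
  positivity

instance pilotLaw_isProbabilityMeasure (n : ℕ) : IsProbabilityMeasure (pilotLaw n) :=
  Measure.isProbabilityMeasure_map (measurable_smul_unitary _).aemeasurable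

theorem ae_uniformOn_mem (U D : ℕ) :
    ∀ᵐ S ∂uniformOn (dataMatrices U D), S ∈ dataMatrices U D :=
  ae_cond_mem (finite_dataMatrices U D).measurableSet

/-- Used by conditioning on the pilots: for almost all of them, eclipsing confines the data to a set
`B` that does not depend on the pilots. -/
theorem prod_real_le_of_ae {α β : Type*} [MeasurableSpace α] [MeasurableSpace β] {μ : Measure α}
    {ν : Measure β} [IsProbabilityMeasure μ] [IsProbabilityMeasure ν] {E : Set (α × β)}
    (hE : MeasurableSet E) {B : Set β} (h : ∀ᵐ a ∂μ, ∀ᵐ b ∂ν, (a, b) ∈ E → b ∈ B) :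
    (μ.prod ν).real E ≤ ν.real B := by
  refine ENNReal.toReal_mono (measure_ne_top ν B) ?_
  rw [Measure.prod_apply hE]
  calc _ ≤ ∫⁻ _, ν B ∂μ := lintegral_mono_ae (h.mono fun a ha => measure_mono_ae ha)
    _ = ν B := by simp

/-! ### Bounds for a deterministic jammer signal -/

/-- The probability that the jammer with signals `wT` and `wD` is eclipsed. -/
noncomputable def eclipseProb {U D : ℕ} (wT : Fin U → ℂ) (wD : Fin D → ℂ) : ℝ :=
  ((pilotLaw U).prod (uniformOn (dataMatrices U D))).real {x | ((wT, wD), x) ∈ eclipseSet U D}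

theorem eclipseProb_le {U D : ℕ} {wT : Fin U → ℂ} {wD : Fin D → ℂ}
    {B : Finset (Matrix (Fin U) (Fin D) ℂ)} (hB : B ⊆ dataFinset U D)
    (h : ∀ᵐ ST ∂pilotLaw U, ∀ S ∈ dataMatrices U D,
      Eclipsed ST S (rowMatrix wT) (rowMatrix wD) → S ∈ B) :
    eclipseProb wT wD ≤ (B.card : ℝ) / (4 ^ D) ^ U := by
  rw [← uniformOn_dataMatrices_real hB]
  refine prod_real_le_of_ae ((measurableSet_eclipseSet U D).preimage measurable_prodMk_left) ?_
  filter_upwards [h] with ST hST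
  filter_upwards [ae_uniformOn_mem U D] with S hS hE
  exact hST S hS hE

/-- This is `(x - 1) ^ 2 ≥ 0` for `x = 2 ^ (L - 1)`. It keeps the bases of the `U`-th powers
nonnegative, so that these powers can be compared. -/
theorem confusion_ratio_le_one {L : ℕ} (hL : L ≠ 0) :
    ((2 : ℝ) ^ L - 1) / 4 ^ (L - 1) ≤ 1 := by
  obtain ⟨L, rfl⟩ := Nat.exists_eq_succ_of_ne_zero hL
  rw [div_le_one (by positivity), Nat.succ_sub_one, pow_succ,
    show (4 : ℝ) ^ L = 2 ^ L * 2 ^ L by rw [← mul_pow]; norm_num]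
  nlinarith [sq_nonneg ((2 : ℝ) ^ L - 1)]

theorem eclipseProb_silent_le {U D : ℕ} (wD : Fin D → ℂ) :
    eclipseProb (0 : Fin U → ℂ) wD ≤ silentPilotBound U wD := by
  classical
  unfold silentPilotBound
  split_ifs with hw
  · exact measureReal_le_one
  have hsub : confusable wD ⊆ qpskVectors D := fun s hs =>
    mem_qpskVectors.mpr (mem_confusable.mp hs).1
  -- The matrices without confusable row form a product over the rows, which is where the power `U`
  -- comes from.
  let A : Finset (Matrix (Fin U) (Fin D) ℂ) :=
    Fintype.piFinset fun _ : Fin U => qpskVectors D \ confusable wD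
  have hA : A ⊆ dataFinset U D := Fintype.piFinset_subset _ _ fun _ => Finset.sdiff_subset
  have hbound : eclipseProb (0 : Fin U → ℂ) wD ≤
      ((dataFinset U D \ A).card : ℝ) / (4 ^ D) ^ U := by
    refine eclipseProb_le Finset.sdiff_subset (Filter.Eventually.of_forall fun ST S hS hE => ?_)
    obtain ⟨u, hu⟩ := eclipsed_silent hw hS hE
    refine Finset.mem_sdiff.mpr ⟨mem_dataFinset.mpr hS, fun hSA => ?_⟩
    exact (Finset.mem_sdiff.mp (Fintype.mem_piFinset.mp hSA u)).2 hu
  have hcardA : (A.card : ℝ) = (4 ^ D - (confusable wD).card) ^ U := by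
    have : A.card = (4 ^ D - (confusable wD).card) ^ U := by
      refine (Fintype.card_piFinset _).trans ?_
      simp [Finset.card_sdiff_of_subset hsub, card_qpskVectors]
    have hle := Finset.card_le_card hsub
    rw [card_qpskVectors] at hle
    rw [this]
    push_cast [Nat.cast_sub hle]
    rfl
  refine hbound.trans ?_
  rw [Finset.card_sdiff_of_subset hA, Nat.cast_sub (Finset.card_le_card hA), hcardA,
    card_dataFinset]
  push_cast
  have h4 : ((4 : ℝ) ^ D) ≠ 0 := by positivity
  rw [sub_div, div_self (by positivity), ← div_pow, sub_div, div_self h4, supportBound]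
  have h1 := card_confusable_le hw
  have h2 := confusion_ratio_le_one (hammingNorm_ne_zero_iff.mpr hw)
  have h3 := pow_le_pow_left₀ (sub_nonneg.mpr h2) (sub_le_sub_left h1 1) U
  linarith

theorem eclipseProb_le_four_pow {U D : ℕ} (hD : 0 < D) {wT : Fin U → ℂ} (hwT : wT ≠ 0)
    {wD : Fin D → ℂ} (h : 2 ≤ U ∨ wD ≠ 0) :
    eclipseProb wT wD ≤ 1 / 4 ^ (D - 1) := by
  classical
  have hU : 0 < U := by
    obtain ⟨k, -⟩ := Function.ne_iff.mp hwT
    exact Fin.pos k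
  let B := (dataFinset U D).filter fun S => Collinear wD S
  have hB : B ⊆ dataFinset U D := Finset.filter_subset _ _
  have hp : eclipseProb wT wD ≤ (B.card : ℝ) / (4 ^ D) ^ U := by
    refine eclipseProb_le hB ?_
    filter_upwards [ae_collinear_of_eclipsed hwT wD] with ST hST S hS hE
    exact Finset.mem_filter.mpr ⟨mem_dataFinset.mpr hS, hST S hS hE⟩
  have hcard := card_collinear_le hU hD h hB fun S hS => (Finset.mem_filter.mp hS).2
  have hcard' : (B.card : ℝ) * 4 ^ (D - 1) ≤ (4 ^ D) ^ U := by exact_mod_cast hcard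
  refine hp.trans ?_
  rw [div_le_div_iff₀ (by positivity) (by positivity), one_mul]
  exact hcard'

theorem eclipseProb_zero_dim {U : ℕ} (wT : Fin U → ℂ) (wD : Fin 0 → ℂ) :
    eclipseProb wT wD ≤ 0 := by
  have h := eclipseProb_le (wT := wT) (wD := wD) (B := ∅) (Finset.empty_subset _)
    (Filter.Eventually.of_forall fun ST S _ ⟨S', _, hne, _⟩ =>
      absurd (Matrix.ext fun _ k => k.elim0) hne)
  simpa using h

/-- The numerator `2 ^ D - 1` is at least 1, and `1 - (1 - x) ^ U ≥ x` on `[0, 1]` for `U ≥ 1`. -/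
theorem four_pow_le_supportBound {U D : ℕ} (hU : 0 < U) (hD : 0 < D) :
    1 / (4 : ℝ) ^ (D - 1) ≤ supportBound U D := by
  have h1 := confusion_ratio_le_one hD.ne'
  have h2 : (2 : ℝ) ≤ 2 ^ D := by
    simpa using pow_le_pow_right₀ (by norm_num : (1 : ℝ) ≤ 2) hD
  have h3 : 1 / (4 : ℝ) ^ (D - 1) ≤ (2 ^ D - 1) / 4 ^ (D - 1) := by
    gcongr
    linarith
  have h4 : 0 ≤ 1 / (4 : ℝ) ^ (D - 1) := by positivity
  have h5 := pow_le_of_le_one (sub_nonneg.mpr h1) (by linarith) hU.ne'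
  unfold supportBound
  linarith

/-- With `y = 2 ^ D` the quotient is `1 / (y + 1)`, and it suffices to treat `U = 2`: `4 / y ^ 2 ≤
(2 * y + 1) / (y + 1) ^ 2` for `y ≥ 4`. For `U = 1` the comparison already fails at `y = 4`. -/
theorem four_pow_le_of_two_le {U D : ℕ} (hU : 2 ≤ U) (hD : 2 ≤ D) :
    1 / (4 : ℝ) ^ (D - 1) ≤ 1 - (1 - ((2 : ℝ) ^ D - 1) / ((4 : ℝ) ^ D - 1)) ^ U := by
  set y : ℝ := 2 ^ D with hy
  have hy4 : 4 ≤ y := by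
    have := pow_le_pow_right₀ (by norm_num : (1 : ℝ) ≤ 2) hD
    norm_num at this
    exact this
  have hyy : (4 : ℝ) ^ D = y * y := by rw [hy, ← mul_pow]; norm_num
  have hq : (y - 1) / ((4 : ℝ) ^ D - 1) = 1 / (y + 1) := by
    rw [hyy, div_eq_div_iff (by nlinarith) (by linarith)]
    ring
  have h4 : 1 / (4 : ℝ) ^ (D - 1) = 4 / (y * y) := by
    rw [← hyy, div_eq_div_iff (by positivity) (by positivity), one_mul, ← pow_succ',
      Nat.sub_add_cancel (by omega)]
  rw [hq, h4]
  have h1 : 1 / (y + 1) ≤ 1 := by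
    rw [div_le_one (by linarith)]
    linarith
  have h0 : 0 ≤ 1 / (y + 1) := by positivity
  have hpow := pow_le_pow_of_le_one (sub_nonneg.mpr h1) (by linarith) hU
  have hmain : 4 / (y * y) ≤ 1 - (1 - 1 / (y + 1)) ^ 2 := by
    have : 1 - (1 - 1 / (y + 1)) ^ 2 = (2 * y + 1) / ((y + 1) * (y + 1)) := by
      field_simp
      ring
    rw [this, div_le_div_iff₀ (by positivity) (by positivity)]
    nlinarith [mul_nonneg (sub_nonneg.mpr hy4) (mul_self_nonneg y),
      mul_nonneg (sub_nonneg.mpr hy4) (by linarith : (0 : ℝ) ≤ y)]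
  linarith

theorem eclipseProb_le_supportBound {U D : ℕ} {wT : Fin U → ℂ} (hwT : wT ≠ 0)
    {wD : Fin D → ℂ} (h : 2 ≤ U ∨ wD ≠ 0) : eclipseProb wT wD ≤ supportBound U D := by
  rcases Nat.eq_zero_or_pos D with rfl | hD
  -- For `D = 0` there is no incorrect candidate, and `supportBound U 0 = 0`.
  · simpa [supportBound] using eclipseProb_zero_dim wT wD
  · have hU : 0 < U := by
      obtain ⟨k, -⟩ := Function.ne_iff.mp hwT
      exact Fin.pos k
    exact (eclipseProb_le_four_pow hD hwT h).trans (four_pow_le_supportBound hU hD)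

end Jamming

/-! ### From deterministic to random jammer signals -/

theorem theorem5 {Ω : Type*} [MeasurableSpace Ω] (P : Measure Ω) [IsProbabilityMeasure P]
    (U D : ℕ)
    (ST : Ω → Matrix (Fin U) (Fin U) ℂ) (SD : Ω → Matrix (Fin U) (Fin D) ℂ)
    (wT : Ω → Fin U → ℂ) (wD : Ω → Fin D → ℂ)
    (hST : Measurable ST) (hSD : Measurable SD) (hwT : Measurable wT) (hwD : Measurable wD)
    (hST_law : P.map ST = Jamming.pilotLaw U)
    (hSD_law : P.map SD = uniformOn (Jamming.dataMatrices U D))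
    (h_indep : IndepFun ST SD P)
    (h_hidden : IndepFun (fun ω => (ST ω, SD ω)) (fun ω => (wT ω, wD ω)) P) :
    MeasurableSet (Jamming.eclipseEvent ST SD wT wD) ∧
    (∀ᵐ ω ∂P, wT ω = 0 →
      (P⟦Jamming.eclipseEvent ST SD wT wD | Jamming.jammerSigma wT wD⟧) ω ≤
        Jamming.silentPilotBound U (wD ω)) ∧
    (∀ᵐ ω ∂P, wT ω ≠ 0 → (2 ≤ U ∨ wD ω ≠ 0) →
      (P⟦Jamming.eclipseEvent ST SD wT wD | Jamming.jammerSigma wT wD⟧) ω ≤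
        Jamming.supportBound U D) ∧
    (∀ᵐ ω ∂P, wT ω ≠ 0 → 2 ≤ U → 2 ≤ D →
      (P⟦Jamming.eclipseEvent ST SD wT wD | Jamming.jammerSigma wT wD⟧) ω ≤
        1 - (1 - ((2 : ℝ) ^ D - 1) / ((4 : ℝ) ^ D - 1)) ^ U) := by
  have hX : Measurable fun ω => (ST ω, SD ω) := hST.prodMk hSD
  have hY : Measurable fun ω => (wT ω, wD ω) := hwT.prodMk hwD
  have hmeas := Jamming.measurableSet_eclipseSet U D
  have hlaw : P.map (fun ω => (ST ω, SD ω)) =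
      (Jamming.pilotLaw U).prod (uniformOn (Jamming.dataMatrices U D)) := by
    rw [← hST_law, ← hSD_law]
    exact (indepFun_iff_map_prod_eq_prod_map_map hST.aemeasurable hSD.aemeasurable).mp h_indep
  have hcond : P⟦Jamming.eclipseEvent ST SD wT wD | Jamming.jammerSigma wT wD⟧ =ᵐ[P]
      fun ω => Jamming.eclipseProb (wT ω) (wD ω) := by
    have h := Jamming.condProb_ae_eq_of_indepFun hX hY h_hidden hmeas
    rw [hlaw] at h
    exact h
  refine ⟨hmeas.preimage (hY.prodMk hX), ?_, ?_, ?_⟩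
  · filter_upwards [hcond] with ω hω h0
    rw [hω, h0]
    exact Jamming.eclipseProb_silent_le (wD ω)
  · filter_upwards [hcond] with ω hω h0 h
    rw [hω]
    exact Jamming.eclipseProb_le_supportBound h0 h
  · filter_upwards [hcond] with ω hω h0 hU hD
    rw [hω]
    exact (Jamming.eclipseProb_le_four_pow (by omega) h0 (Or.inl hU)).trans
      (Jamming.four_pow_le_of_two_le hU hD)
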